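/- **Theorem 1.7.** Let $d\ge 3$, let $\Gamma=\mathbb Z^d$ and $\Gamma^*=(\mathbb R/2\pi\mathbb Z)^d$ with normalized Haar measure $\mu^*$. Let $\mathfrak e\in C^2(\Gamma^*,\mathbb R)$ be an admissible dispersion relation, i.e. a Morse function (all critical points are nondegenerate) with range $\mathfrak e(\Gamma^*)=[0,\mathfrak e_{\max}]$. Let $h(\mathfrak e)=\mathcal F\,\mathfrak e\,\mathcal F^*$ be the Fourier multiplier on $\ell^2(\Gamma)$ with symbol $\mathfrak e$, where $[\mathcal F^*\varphi](p)=\sum_{x\in\Gamma}e^{-i\langle p,x\rangle}\varphi(x)$. For a bounded potential $V:\Gamma\to[0,\infty)$ with $V(x)\to0$ as $|x|\to\infty$, let $N[\mathfrak e,V]$ be the number of negative eigenvalues, counted with multiplicities, of $H(\mathfrak e,V)=h(\mathfrak e)-V$ on $\ell^2(\Gamma)$, and let $$N_{sc}[\mathfrak e,V]=\sum_{x\in\Gamma}\mu^*\big(\{p\in\Gamma^*:\ \mathfrak e(p)-V(x)<0\}\big),\qquad \mathcal L_V[\alpha]=\#\{x\in\Gamma:\ V(x)\ge\alpha\}\quad(\alpha>0),$$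 $$g_+(V)=\sup_{r>0}\ \limsup_{\ell\to\infty}\ \frac{2}{d\,r}\Big(\ln\mathcal L_V[e^{-\ell-r}]-\ln\mathcal L_V[e^{-\ell}]\Big)\ \in[0,\infty]\qquad(V\ne0).$$ Then there are constants $0<c_s\le c_g<\infty$, depending only on $d$ and $\mathfrak e$, such that for every $V\in\ell^{d/2}(\Gamma,[0,\infty))$ with $V\ne0$ one has $0<N_{sc}[\mathfrak e,\lambda V]<\infty$ for all $\lambda>0$, and $$\big(1-g_+(V)\big)\,c_s\ \le\ \liminf_{\lambda\to\infty}\frac{N[\mathfrak e,\lambda V]}{N_{sc}[\mathfrak e,\lambda V]}\ \le\ \limsup_{\lambda\to\infty}\frac{N[\mathfrak e,\lambda V]}{N_{sc}[\mathfrak e,\lambda V]}\ \le\ c_g .$$ (If $g_+(V)=\infty$, the left side is $-\infty$.) -/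

import Mathlib

open MeasureTheory Filter Topology
open scoped ENNReal lp

noncomputable section

namespace LatticeSchrodinger

/-- The hypercubic lattice `Γ = ℤ^d`. -/
abbrev IntLattice (d : ℕ) : Type := Fin d → ℤ

instance factTwoPiPos : Fact ((0 : ℝ) < 2 * Real.pi) := ⟨Real.two_pi_pos⟩

/-- The torus `Γ* = (ℝ / 2πℤ)^d`, the dual group of `Γ`. -/
abbrev Torus (d : ℕ) : Type := Fin d → AddCircle (2 * Real.pi)

/-- The normalized Haar measure `dμ*(p) = dp / (2π)^d` on `Γ*`. -/
def torusMeasure (d : ℕ) : Measure (Torus d) :=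
  Measure.pi fun _ => AddCircle.haarAddCircle

instance torusMeasure_isProbabilityMeasure (d : ℕ) : IsProbabilityMeasure (torusMeasure d) := by
  unfold torusMeasure; infer_instance

/-! ### Admissible dispersion relations -/

/-- The `2π`-periodic function on `ℝ^d` that corresponds to a function on the torus. -/
def periodicLift {d : ℕ} (e : Torus d → ℝ) : (Fin d → ℝ) → ℝ :=
  fun p => e fun i => (p i : AddCircle (2 * Real.pi))

/-- A `C²` Morse function on the torus: all its critical points are nondegenerate. Smoothness, the
differential and the Hessian are read off in the coordinates given by the covering `ℝ^d → Γ*`. -/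
structure IsMorse {d : ℕ} (e : Torus d → ℝ) : Prop where
  contDiff : ContDiff ℝ 2 (periodicLift e)
  nondegenerate : ∀ p : Fin d → ℝ, fderiv ℝ (periodicLift e) p = 0 →
    ∀ v : Fin d → ℝ, (∀ w : Fin d → ℝ, fderiv ℝ (fderiv ℝ (periodicLift e)) p v w = 0) → v = 0

/-- An admissible dispersion relation: a `C²` Morse function on the torus whose range is
`[0, e_max]` for some number `e_max`. -/
structure IsAdmissible {d : ℕ} (e : C(Torus d, ℝ)) : Prop where
  isMorse : IsMorse e
  range_eq : ∃ emax : ℝ, Set.range e = Set.Icc 0 emax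

/-! ### The Fourier transform and the hopping matrix -/

/-- The character `p ↦ exp (-i ⟨p, x⟩)` of the torus. -/
def character {d : ℕ} (x : IntLattice d) : C(Torus d, ℂ) where
  toFun p := ∏ i, fourier (-x i) (p i)
  continuous_toFun := by fun_prop

/-- The character `p ↦ exp (-i ⟨p, x⟩)` as an element of `L²(Γ*)`. -/
def characterLp {d : ℕ} (x : IntLattice d) : Lp ℂ 2 (torusMeasure d) :=
  ContinuousMap.toLp 2 (torusMeasure d) ℂ (character x)

theorem orthonormal_characterLp (d : ℕ) :
    Orthonormal ℂ (characterLp : IntLattice d → Lp ℂ 2 (torusMeasure d)) := by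
  rw [orthonormal_iff_ite]
  intro m n
  have key : ∀ i, ∫ t : AddCircle (2 * Real.pi),
      fourier (-n i) t * (starRingEnd ℂ) (fourier (-m i) t) ∂AddCircle.haarAddCircle
        = if m i = n i then 1 else 0 := by
    intro i
    have h := (orthonormal_iff_ite.mp (orthonormal_fourier (T := 2 * Real.pi))) (-m i) (-n i)
    rw [ContinuousMap.inner_toLp] at h
    simpa [neg_inj] using h
  simp only [characterLp, ContinuousMap.inner_toLp]
  have h2 : (fun p : Torus d => character n p * (starRingEnd ℂ) (character m p)) =
      fun p : Torus d => ∏ i, (fourier (-n i) (p i) * (starRingEnd ℂ) (fourier (-m i) (p i))) := by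
    funext p
    simp [character, Finset.prod_mul_distrib, map_prod]
  have h3 : ∫ p : Torus d, character n p * (starRingEnd ℂ) (character m p) ∂(torusMeasure d) =
      ∏ i, (if m i = n i then (1 : ℂ) else 0) := by
    rw [h2, torusMeasure]
    rw [MeasureTheory.integral_fintype_prod_eq_prod (𝕜 := ℂ)
      (fun i (t : AddCircle (2 * Real.pi)) =>
        fourier (-n i) t * (starRingEnd ℂ) (fourier (-m i) t))]
    exact Finset.prod_congr rfl fun i _ => key i
  rw [h3]
  by_cases h : m = n
  · simp [h]
  · obtain ⟨i, hi⟩ := Function.ne_iff.mp h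
    rw [if_neg h]
    exact Finset.prod_eq_zero (Finset.mem_univ i) (by simp [hi])

/-- The Hilbert space `ℓ²(Γ)`. -/
abbrev HilbertSpace (d : ℕ) : Type := lp (fun _ : IntLattice d => ℂ) 2

/-- The discrete Fourier transformation `ℱ* : ℓ²(Γ) → L²(Γ*)`,
`(ℱ* φ)(p) = ∑ x, exp (-i ⟨p, x⟩) φ x`, the series converging in `L²(Γ*)`. -/
def fourierStar (d : ℕ) : HilbertSpace d →ₗᵢ[ℂ] Lp ℂ 2 (torusMeasure d) :=
  (orthonormal_characterLp d).orthogonalFamily.linearIsometry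

/-- Multiplication by `e` on `L²(Γ*)`. -/
def torusMul {d : ℕ} (e : C(Torus d, ℝ)) :
    Lp ℂ 2 (torusMeasure d) →L[ℂ] Lp ℂ 2 (torusMeasure d) :=
  (ContinuousLinearMap.mul ℂ ℂ).holderL (torusMeasure d) ∞ 2 2
    (ContinuousMap.toLp ∞ (torusMeasure d) ℂ
      ((⟨Complex.ofReal, Complex.continuous_ofReal⟩ : C(ℝ, ℂ)).comp e))

/-- The hopping matrix `h(e) = ℱ e ℱ*` on `ℓ²(Γ)`; the unitary `ℱ*` has as its inverse `ℱ` its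
adjoint. -/
def hopping {d : ℕ} (e : C(Torus d, ℝ)) : HilbertSpace d →L[ℂ] HilbertSpace d :=
  (ContinuousLinearMap.adjoint (fourierStar d).toContinuousLinearMap).comp
    ((torusMul e).comp (fourierStar d).toContinuousLinearMap)

/-! ### Potentials and the Schrödinger operator -/

/-- Bounded real potentials, `ℓ^∞(Γ, ℝ)`. -/
abbrev Potential (d : ℕ) : Type := lp (fun _ : IntLattice d => ℝ) ∞

theorem norm_potential_mul_le {d : ℕ} (V : Potential d) (φ : HilbertSpace d) (x : IntLattice d) :
    ‖(V x : ℂ) * φ x‖ ≤ ‖((‖V‖ : ℂ) • φ) x‖ := by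
  have h : ‖V x‖ ≤ ‖V‖ := lp.norm_apply_le_norm (by simp) V x
  simp only [lp.coeFn_smul, Pi.smul_apply, smul_eq_mul, norm_mul, Complex.norm_real, norm_norm]
  exact mul_le_mul_of_nonneg_right h (norm_nonneg _)

theorem memℓp_potential_mul {d : ℕ} (V : Potential d) (φ : HilbertSpace d) :
    Memℓp (fun x => (V x : ℂ) * φ x) 2 :=
  (lp.memℓp ((‖V‖ : ℂ) • φ)).mono' (norm_potential_mul_le V φ)

/-- Multiplication by the potential `V` on `ℓ²(Γ)`, `(V φ)(x) = V x * φ x`. -/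
def potentialMul {d : ℕ} (V : Potential d) : HilbertSpace d →L[ℂ] HilbertSpace d :=
  LinearMap.mkContinuous
    { toFun := fun φ => ⟨fun x => (V x : ℂ) * φ x, memℓp_potential_mul V φ⟩
      map_add' := fun φ ψ => by ext x; exact mul_add _ _ _
      map_smul' := fun c φ => by ext x; exact mul_left_comm _ _ _ }
    ‖V‖ (fun φ => by
      have h := lp.norm_mono (p := 2) (by simp)
        (x := (⟨fun x => (V x : ℂ) * φ x, memℓp_potential_mul V φ⟩ : HilbertSpace d))
        (y := (‖V‖ : ℂ) • φ) (norm_potential_mul_le V φ)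
      rw [norm_smul] at h
      simpa using h)

/-- The Schrödinger operator `H(e, V) = h(e) - V` on `ℓ²(Γ)`. -/
def schrodinger {d : ℕ} (e : C(Torus d, ℝ)) (V : Potential d) :
    HilbertSpace d →L[ℂ] HilbertSpace d :=
  hopping e - potentialMul V

/-- The number `N[e, V]` of negative eigenvalues of `H(e, V)`, counted with multiplicities: the sum
of the dimensions of the eigenspaces over all negative numbers. For `V` vanishing at infinity the
spectrum of `H(e, V)` in `(-∞, 0)` consists of isolated eigenvalues of finite multiplicity, and this
is the trace of the spectral projection of `H(e, V)` onto `(-∞, 0)`. -/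
def boundStates {d : ℕ} (e : C(Torus d, ℝ)) (V : Potential d) : ℝ≥0∞ :=
  ∑' E : Set.Iio (0 : ℝ),
    ((Module.rank ℂ (Module.End.eigenspace
      (schrodinger e V : HilbertSpace d →ₗ[ℂ] HilbertSpace d) ((E : ℝ) : ℂ))).toENat : ℝ≥0∞)

/-- The semi-classical number of bound states
`N_sc[e, V] = ∑ x, ∫ 1[e(p) - V x < 0] dμ*(p)`. -/
def semiclassical {d : ℕ} (e : C(Torus d, ℝ)) (V : Potential d) : ℝ≥0∞ :=
  ∑' x : IntLattice d, torusMeasure d {p : Torus d | e p - V x < 0}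

/-! ### Level sets -/

/-- The size `L_V[α] = #{x | V x ≥ α}` of a level set of `V`. For `V` vanishing at infinity and
`α > 0` the level set is finite. -/
def levelCount {d : ℕ} (V : Potential d) (α : ℝ) : ℕ :=
  Set.ncard {x : IntLattice d | α ≤ V x}

/-- The upper growth exponent
`g₊(V) = sup_{r > 0} limsup_{ℓ → ∞} (2 / (d r)) (ln L_V[exp (-ℓ - r)] - ln L_V[exp (-ℓ)])`
as an extended real number. For nonzero `V ≥ 0` vanishing at infinity, both level sets are
nonempty and finite as soon as `ℓ` is large. -/
def gPlus {d : ℕ} (V : Potential d) : EReal :=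
  ⨆ r : Set.Ioi (0 : ℝ), limsup (fun l : ℝ =>
    ((2 / (d * (r : ℝ)) * (Real.log (levelCount V (Real.exp (-l - r)))
      - Real.log (levelCount V (Real.exp (-l)))) : ℝ) : EReal)) atTop

end LatticeSchrodinger

end

open LatticeSchrodinger

/-! Everything is compared with the truncated power sum S(V) = ∑ₓ min(V x, 1)^{d/2}. The zeros of
`e` are nondegenerate minima, so `e` is comparable there to the squared distance. Hence {e < v} has
measure of order v^{d/2} for small v, and N_sc is comparable to S(V) (`exists_le_semiclassical`,
`exists_semiclassical_le`).

Upper bound: N ≤ C S(V) (`exists_boundStates_le`). Requiring φ x = 0 at the sites with V x ≥ 1 costs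
one dimension per site; the rest is the Cwikel–Lieb–Rozenblum bound (`exists_finrank_le_sum_rpow`).
On a space where the form of h(e) is dominated by a weight w, take a basis orthonormal for the form
of h(e) and split the evaluation at x at an energy E of order w x. By Bessel the low energies
contribute at most ∫_{e ≤ E} 1/e, of order E^{d/2-1}; this is where d ≥ 3 enters. The high energies,
summed over x by Bessel for the characters and a dyadic layer cake, contribute at most half the
dimension and are absorbed.

Lower bound: delta functions at sites where λV exceeds e_max span a negative subspace, so N is at
least a level count of V at height of order 1/λ (`card_le_boundStates`). If g₊ < γ < 1, lowering the
level by a factor of Euler's number enlarges the level set by at most exp(γd/2), so the layer cake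
of S(λV) is dominated by a geometric series whose sum is at most a constant times the level count
over 1 - γ (`eventually_tsum_min_rpow_le`). Then γ ↓ g₊. For g₊ ≥ 1 the lower bound is trivial.

Both estimates use the variational characterization of the span of the negative eigenspaces
(`boundStates_le`, `finrank_le_boundStates`). -/

/-! ### Quadratic bounds for nonnegative functions with bounded second derivative -/

theorem bounded_of_periodic {d : ℕ} {F : Type*} [NormedAddCommGroup F] {g : (Fin d → ℝ) → F}
    (hg : Continuous g) (hper : ∀ (p : Fin d → ℝ) (n : Fin d → ℤ),
      g (p + fun i => n i * (2 * Real.pi)) = g p) :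
    ∃ M : ℝ, 0 < M ∧ ∀ p, ‖g p‖ ≤ M := by
  obtain ⟨M, hM⟩ := (isCompact_Icc (a := (0 : Fin d → ℝ))
    (b := fun _ => 2 * Real.pi)).exists_bound_of_continuousOn hg.continuousOn
  refine ⟨max M 1, by positivity, fun p => ?_⟩
  rw [← hper p fun i => -⌊p i / (2 * Real.pi)⌋]
  refine (hM _ ⟨fun i => ?_, fun i => ?_⟩).trans (le_max_left _ _)
  · have h := Int.floor_le (p i / (2 * Real.pi))
    rw [le_div_iff₀ Real.two_pi_pos] at h
    simp only [Pi.zero_apply, Pi.add_apply, Int.cast_neg]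
    linarith
  · have h := Int.lt_floor_add_one (p i / (2 * Real.pi))
    rw [div_lt_iff₀ Real.two_pi_pos] at h
    simp only [Pi.add_apply, Int.cast_neg]
    linarith

section Quadratic

variable {E : Type*} [NormedAddCommGroup E] [NormedSpace ℝ E] {f : E → ℝ} {M : ℝ}

theorem le_taylor_of_norm_fderiv_fderiv_le (hf : ContDiff ℝ 2 f)
    (hM : ∀ p, ‖fderiv ℝ (fderiv ℝ f) p‖ ≤ M) (p w : E) :
    f (p + w) ≤ f p + fderiv ℝ f p w + M * ‖w‖ ^ 2 := by
  have hM0 : 0 ≤ M := (norm_nonneg (fderiv ℝ (fderiv ℝ f) p)).trans (hM p)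
  have hd : Differentiable ℝ (fderiv ℝ f) :=
    (hf.fderiv_right (m := 1) (by norm_num)).differentiable (by norm_num)
  have key := (convex_segment p (p + w)).norm_image_sub_le_of_norm_fderiv_le' (f := f)
    (φ := fderiv ℝ f p) (C := M * ‖w‖) (x := p) (y := p + w)
    (fun x _ => hf.differentiable (by norm_num) x) (fun x hx => ?_)
    (left_mem_segment ℝ _ _) (right_mem_segment ℝ _ _)
  · rw [add_sub_cancel_left, Real.norm_eq_abs] at key
    have := (abs_le.mp key).2
    nlinarith
  · have h := convex_univ.norm_image_sub_le_of_norm_fderiv_le (f := fderiv ℝ f) (x := p) (y := x)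
      (fun y _ => hd y) (fun y _ => hM y) trivial trivial
    refine h.trans (mul_le_mul_of_nonneg_left ?_ hM0)
    rw [segment_eq_image'] at hx
    obtain ⟨t, ht, rfl⟩ := hx
    simp only [add_sub_cancel_left, norm_smul, Real.norm_eq_abs, abs_of_nonneg ht.1]
    exact mul_le_of_le_one_left (norm_nonneg _) ht.2

/-- Along any line the quadratic Taylor majorant of `f` must stay nonnegative; evaluating it at its
minimum bounds the slope. It shows that zeros of `f` are critical and turns gradient bounds into
bounds on `f`. -/
theorem sq_norm_fderiv_le (hf : ContDiff ℝ 2 f) (h0 : ∀ p, 0 ≤ f p) (hMpos : 0 < M)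
    (hM : ∀ p, ‖fderiv ℝ (fderiv ℝ f) p‖ ≤ M) (p : E) :
    ‖fderiv ℝ f p‖ ^ 2 ≤ 4 * M * f p := by
  have key : ‖fderiv ℝ f p‖ ≤ Real.sqrt (4 * M * f p) := by
    refine ContinuousLinearMap.opNorm_le_bound _ (Real.sqrt_nonneg _) fun u => ?_
    rw [Real.norm_eq_abs]
    by_cases hu : u = 0
    · simp [hu]
    have hu' : 0 < ‖u‖ := norm_pos_iff.mpr hu
    set D := fderiv ℝ f p u with hD
    -- This multiple of `u` minimizes the majorant t ↦ f p + t D + M t² ‖u‖².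
    have h := le_taylor_of_norm_fderiv_fderiv_le hf hM p (-(D / (2 * M * ‖u‖ ^ 2)) • u)
    have h2 := (h0 _).trans h
    rw [map_smul, norm_smul, ← hD, smul_eq_mul, norm_neg, Real.norm_eq_abs, mul_pow, sq_abs] at h2
    have h3 : f p + -(D / (2 * M * ‖u‖ ^ 2)) * D + M * ((D / (2 * M * ‖u‖ ^ 2)) ^ 2 * ‖u‖ ^ 2)
        = f p - D ^ 2 / (4 * M * ‖u‖ ^ 2) := by
      field_simp
      ring
    rw [h3, sub_nonneg, div_le_iff₀ (by positivity)] at h2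
    refine abs_le_of_sq_le_sq ?_ (by positivity)
    rw [mul_pow, Real.sq_sqrt (mul_nonneg (by positivity) (h0 p))]
    linarith
  calc ‖fderiv ℝ f p‖ ^ 2 ≤ (Real.sqrt (4 * M * f p)) ^ 2 := by gcongr
    _ = _ := Real.sq_sqrt (mul_nonneg (by positivity) (h0 p))

/-- Positivity of the Hessian is never needed. An injective Hessian makes the gradient grow at least
linearly away from `p`, and `sq_norm_fderiv_le` bounds `f` below by the squared gradient. -/
theorem eventually_quadratic_le [FiniteDimensional ℝ E] (hf : ContDiff ℝ 2 f) (h0 : ∀ p, 0 ≤ f p)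
    (hMpos : 0 < M) (hM : ∀ p, ‖fderiv ℝ (fderiv ℝ f) p‖ ≤ M) {p : E} (hp : f p = 0)
    (hnd : ∀ v, (∀ w, fderiv ℝ (fderiv ℝ f) p v w = 0) → v = 0) :
    ∃ c : ℝ, 0 < c ∧ ∀ᶠ q in 𝓝 p, c * ‖q - p‖ ^ 2 ≤ f q := by
  have hD0 : fderiv ℝ f p = 0 := by
    have h := sq_norm_fderiv_le hf h0 hMpos hM p
    rw [hp, mul_zero] at h
    exact norm_eq_zero.mp (pow_eq_zero_iff (n := 2) (by norm_num) |>.mp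
      (le_antisymm h (by positivity)))
  have hd : DifferentiableAt ℝ (fderiv ℝ f) p :=
    (hf.fderiv_right (m := 1) (by norm_num)).differentiable (by norm_num) p
  set T := fderiv ℝ (fderiv ℝ f) p with hT
  obtain ⟨K, hK, hanti⟩ := LinearMap.exists_antilipschitzWith (T : E →ₗ[ℝ] E →L[ℝ] ℝ)
    (LinearMap.ker_eq_bot'.mpr fun v hv => hnd v fun w => by
      have : T v = 0 := hv
      rw [this]; rfl)
  have hK' : (0 : ℝ) < K := hK
  have hbd : ∀ v, ‖v‖ ≤ K * ‖T v‖ := fun v => by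
    simpa using hanti.le_mul_dist v 0
  have ho := (hasFDerivAt_iff_isLittleO.mp hd.hasFDerivAt).def (c := 1 / (2 * K)) (by positivity)
  refine ⟨(1 / (2 * K)) ^ 2 / (4 * M), by positivity, ?_⟩
  filter_upwards [ho] with q hq
  rw [hD0, sub_zero, ← hT] at hq
  have h1 : ‖T (q - p)‖ ≤ ‖fderiv ℝ f q‖ + ‖fderiv ℝ f q - T (q - p)‖ := by
    have := norm_sub_le (fderiv ℝ f q) (fderiv ℝ f q - T (q - p))
    simpa using this
  have h2 := hbd (q - p)
  have h3 : ‖q - p‖ / K ≤ ‖T (q - p)‖ := by rw [div_le_iff₀ hK']; linarith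
  have h4 : 1 / (2 * K) * ‖q - p‖ ≤ ‖fderiv ℝ f q‖ := by
    have : ‖q - p‖ / K = 1 / (2 * K) * ‖q - p‖ + 1 / (2 * K) * ‖q - p‖ := by field_simp; ring
    linarith
  have h5 := sq_norm_fderiv_le hf h0 hMpos hM q
  rw [div_mul_eq_mul_div, div_le_iff₀ (by positivity), ← mul_pow]
  calc _ ≤ ‖fderiv ℝ f q‖ ^ 2 := by gcongr
    _ ≤ _ := by linarith

end Quadratic

/-! ### The distribution function of a dispersion relation -/

/-- Near a zero the quadratic lower bound confines the sublevel set to a ball of radius of order √v.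
Near any other point `f` stays above f p / 2, so only v > f p / 2 matters, and for these the volume
of a unit ball is already of the required form. -/
theorem volume_sublevel_inter_local {d : ℕ} {f : (Fin d → ℝ) → ℝ} {M : ℝ} (hf : ContDiff ℝ 2 f)
    (h0 : ∀ p, 0 ≤ f p) (hMpos : 0 < M) (hM : ∀ p, ‖fderiv ℝ (fderiv ℝ f) p‖ ≤ M)
    (hnd : ∀ p, fderiv ℝ f p = 0 → ∀ v, (∀ w, fderiv ℝ (fderiv ℝ f) p v w = 0) → v = 0)
    (p : Fin d → ℝ) :
    ∃ U ∈ 𝓝 p, ∃ C : ℝ, 0 ≤ C ∧ ∀ v : ℝ, 0 < v →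
      volume ({q | f q < v} ∩ U) ≤ ENNReal.ofReal (C * v ^ ((d : ℝ) / 2)) := by
  have hsqrt : ∀ x : ℝ, 0 ≤ x → (Real.sqrt x) ^ d = x ^ ((d : ℝ) / 2) := fun x hx => by
    rw [Real.sqrt_eq_rpow, ← Real.rpow_natCast, ← Real.rpow_mul hx]
    congr 1; ring
  rcases (h0 p).eq_or_lt with hp | hp
  · have hD0 : fderiv ℝ f p = 0 := by
      have h := sq_norm_fderiv_le hf h0 hMpos hM p
      rw [← hp, mul_zero] at h
      exact norm_eq_zero.mp (pow_eq_zero_iff (n := 2) (by norm_num) |>.mp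
        (le_antisymm h (by positivity)))
    obtain ⟨c, hc, hev⟩ := eventually_quadratic_le hf h0 hMpos hM hp.symm (hnd p hD0)
    refine ⟨_, hev, 2 ^ d * (1 / c) ^ ((d : ℝ) / 2), by positivity, fun v hv => ?_⟩
    have hs : 0 < Real.sqrt (1 / c * v) := by positivity
    calc volume ({q | f q < v} ∩ {q | c * ‖q - p‖ ^ 2 ≤ f q})
        ≤ volume (Metric.ball p (Real.sqrt (1 / c * v))) := by
          refine measure_mono fun q hq => ?_
          rw [Metric.mem_ball, dist_eq_norm, Real.lt_sqrt (norm_nonneg _), one_div_mul_eq_div,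
            lt_div_iff₀ hc]
          have h1 : f q < v := hq.1
          have h2 : c * ‖q - p‖ ^ 2 ≤ f q := hq.2
          linarith
      _ = _ := by
          rw [Real.volume_pi_ball p hs, Fintype.card_fin, mul_pow, hsqrt _ (by positivity),
            Real.mul_rpow (by positivity) hv.le, mul_assoc]
  · refine ⟨{q | f p / 2 < f q} ∩ Metric.ball p 1, inter_mem
      ((isOpen_lt continuous_const hf.continuous).mem_nhds (half_lt_self hp))
      (Metric.ball_mem_nhds p one_pos), 2 ^ d * (2 / f p) ^ ((d : ℝ) / 2), by positivity,
      fun v hv => ?_⟩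
    rcases le_or_gt v (f p / 2) with h | h
    · have : {q | f q < v} ∩ ({q | f p / 2 < f q} ∩ Metric.ball p 1) = ∅ := by
        ext q
        simp only [Set.mem_inter_iff, Set.mem_ofPred_eq, Set.mem_empty_iff_false, iff_false]
        rintro ⟨h1, h2, -⟩
        linarith
      simp [this]
    · calc _ ≤ volume (Metric.ball p 1) :=
            measure_mono (Set.inter_subset_right.trans Set.inter_subset_right)
        _ = ENNReal.ofReal (2 ^ d) := by
            rw [Real.volume_pi_ball p one_pos, Fintype.card_fin, mul_one]
        _ ≤ _ := by
            refine ENNReal.ofReal_le_ofReal ?_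
            rw [mul_assoc, ← Real.mul_rpow (by positivity) hv.le]
            refine le_mul_of_one_le_right (by positivity) (Real.one_le_rpow ?_ (by positivity))
            rw [div_mul_eq_mul_div, le_div_iff₀ hp]
            linarith

theorem volume_sublevel_inter_compact {d : ℕ} {f : (Fin d → ℝ) → ℝ} {M : ℝ} (hf : ContDiff ℝ 2 f)
    (h0 : ∀ p, 0 ≤ f p) (hMpos : 0 < M) (hM : ∀ p, ‖fderiv ℝ (fderiv ℝ f) p‖ ≤ M)
    (hnd : ∀ p, fderiv ℝ f p = 0 → ∀ v, (∀ w, fderiv ℝ (fderiv ℝ f) p v w = 0) → v = 0)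
    {K : Set (Fin d → ℝ)} (hK : IsCompact K) :
    ∃ C : ℝ, 0 ≤ C ∧ ∀ v : ℝ, 0 < v →
      volume ({q | f q < v} ∩ K) ≤ ENNReal.ofReal (C * v ^ ((d : ℝ) / 2)) := by
  refine hK.induction_on (p := fun K => ∃ C : ℝ, 0 ≤ C ∧ ∀ v : ℝ, 0 < v →
      volume ({q | f q < v} ∩ K) ≤ ENNReal.ofReal (C * v ^ ((d : ℝ) / 2))) ⟨0, le_rfl, by simp⟩
    ?_ ?_ ?_
  · rintro s t hst ⟨C, hC, h⟩
    exact ⟨C, hC, fun v hv => (measure_mono (by gcongr)).trans (h v hv)⟩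
  · rintro s t ⟨C, hC, h⟩ ⟨C', hC', h'⟩
    refine ⟨C + C', by positivity, fun v hv => ?_⟩
    rw [Set.inter_union_distrib_left, add_mul, ENNReal.ofReal_add (by positivity) (by positivity)]
    exact (measure_union_le _ _).trans (add_le_add (h v hv) (h' v hv))
  · intro p _
    obtain ⟨U, hU, h⟩ := volume_sublevel_inter_local hf h0 hMpos hM hnd p
    exact ⟨U, mem_nhdsWithin_of_mem_nhds hU, h⟩

namespace LatticeSchrodinger

theorem measurePreserving_torus {d : ℕ} (t : Fin d → ℝ) :
    MeasurePreserving (fun (p : Fin d → ℝ) i => (p i : AddCircle (2 * Real.pi)))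
      (Measure.pi fun i => (ENNReal.ofReal (2 * Real.pi))⁻¹ •
        volume.restrict (Set.Ioc (t i) (t i + 2 * Real.pi)))
      (torusMeasure d) := by
  refine measurePreserving_pi _ _ fun i => ?_
  have h := (AddCircle.measurePreserving_mk (2 * Real.pi) (t i)).smul_measure
    ((ENNReal.ofReal (2 * Real.pi))⁻¹)
  rwa [AddCircle.volume_eq_smul_haarAddCircle, smul_smul, ENNReal.inv_mul_cancel
    (by simpa using Real.pi_pos) ENNReal.ofReal_ne_top, one_smul] at h

/-- The corner `t` of the fundamental cube is left free so that the cube can be centred at a zero of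
the symbol. -/
theorem torusMeasure_apply {d : ℕ} (t : Fin d → ℝ) {A : Set (Torus d)} (hA : MeasurableSet A) :
    torusMeasure d A = (ENNReal.ofReal (2 * Real.pi))⁻¹ ^ d *
      volume ({p : Fin d → ℝ | (fun i => (p i : AddCircle (2 * Real.pi))) ∈ A} ∩
        Set.pi Set.univ fun i => Set.Ioc (t i) (t i + 2 * Real.pi)) := by
  have hpi : (Measure.pi fun i => (ENNReal.ofReal (2 * Real.pi))⁻¹ •
        volume.restrict (Set.Ioc (t i) (t i + 2 * Real.pi)))
      = (ENNReal.ofReal (2 * Real.pi))⁻¹ ^ d • (volume : Measure (Fin d → ℝ)).restrict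
        (Set.pi Set.univ fun i => Set.Ioc (t i) (t i + 2 * Real.pi)) := by
    have : ∀ i, SigmaFinite ((ENNReal.ofReal (2 * Real.pi))⁻¹ •
        (volume : Measure ℝ).restrict (Set.Ioc (t i) (t i + 2 * Real.pi))) := fun i =>
      Measure.smul_finite _ (by simp [Real.pi_pos]) |>.toSigmaFinite
    refine Measure.pi_eq fun s hs => ?_
    rw [volume_pi, Measure.restrict_pi_pi, Measure.smul_apply, Measure.pi_pi]
    simp [Finset.prod_mul_distrib]
  have h := measurePreserving_torus t
  rw [hpi] at h
  rw [← h.measure_preimage hA.nullMeasurableSet, Measure.smul_apply, smul_eq_mul,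
    Measure.restrict_apply (h.measurable hA)]
  rfl

variable {d : ℕ} {e : C(Torus d, ℝ)}

theorem IsAdmissible.nonneg (he : IsAdmissible e) (p : Torus d) : 0 ≤ e p := by
  obtain ⟨m, hm⟩ := he.range_eq
  exact (hm ▸ Set.mem_range_self p : e p ∈ Set.Icc 0 m).1

theorem IsAdmissible.exists_eq_zero (he : IsAdmissible e) : ∃ p, e p = 0 := by
  obtain ⟨m, hm⟩ := he.range_eq
  have h : e 0 ∈ Set.Icc 0 m := hm ▸ Set.mem_range_self (0 : Torus d)
  have : (0 : ℝ) ∈ Set.range e := hm ▸ ⟨le_rfl, h.1.trans h.2⟩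
  exact this

theorem periodicLift_add (e : Torus d → ℝ) (p : Fin d → ℝ) (n : Fin d → ℤ) :
    periodicLift e (p + fun i => n i * (2 * Real.pi)) = periodicLift e p := by
  unfold periodicLift
  congr 1
  funext i
  simp only [Pi.add_apply, ← zsmul_eq_mul]
  rw [AddCircle.coe_add, AddCircle.coe_zsmul, AddCircle.coe_period, smul_zero, add_zero]

theorem IsMorse.exists_norm_fderiv_fderiv_le {e : Torus d → ℝ} (he : IsMorse e) :
    ∃ M : ℝ, 0 < M ∧ ∀ p, ‖fderiv ℝ (fderiv ℝ (periodicLift e)) p‖ ≤ M := by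
  refine bounded_of_periodic (g := fderiv ℝ (fderiv ℝ (periodicLift e))) ?_ fun p n => ?_
  · exact (he.contDiff.fderiv_right (m := 1) (by norm_num)).continuous_fderiv (by norm_num)
  · have h1 : ∀ q, fderiv ℝ (periodicLift e) (q + fun i => n i * (2 * Real.pi))
        = fderiv ℝ (periodicLift e) q := fun q => by
      have h := fderiv_comp_add_right (𝕜 := ℝ) (f := periodicLift e) (x := q)
        (fun i => n i * (2 * Real.pi))
      rw [← h]
      simp_rw [periodicLift_add]
    have h2 := fderiv_comp_add_right (𝕜 := ℝ) (f := fderiv ℝ (periodicLift e)) (x := p)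
      (fun i => n i * (2 * Real.pi))
    rw [← h2]
    simp_rw [h1]

theorem IsAdmissible.measure_sublevel_le (he : IsAdmissible e) :
    ∃ C : ℝ, 0 < C ∧ ∀ v : ℝ, 0 < v →
      torusMeasure d {p | e p < v} ≤ ENNReal.ofReal (C * v ^ ((d : ℝ) / 2)) := by
  obtain ⟨M, hM0, hM⟩ := he.isMorse.exists_norm_fderiv_fderiv_le
  obtain ⟨C, hC0, hC⟩ := volume_sublevel_inter_compact he.isMorse.contDiff
    (fun p => he.nonneg _) hM0 hM he.isMorse.nondegenerate
    (isCompact_Icc (a := (0 : Fin d → ℝ)) (b := fun _ => 2 * Real.pi))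
  refine ⟨C + 1, by positivity, fun v hv => ?_⟩
  rw [torusMeasure_apply 0 (measurableSet_lt e.continuous.measurable measurable_const)]
  refine (mul_le_of_le_one_left' (pow_le_one₀ (by simp) ?_)).trans
    ((measure_mono ?_).trans ((hC v hv).trans (ENNReal.ofReal_le_ofReal ?_)))
  · rw [ENNReal.inv_le_one, ENNReal.one_le_ofReal]
    linarith [Real.pi_gt_three]
  · rintro p ⟨hp, hp'⟩
    refine ⟨hp, fun i => ?_, fun i => ?_⟩
    · exact (hp' i trivial).1.le
    · simpa using (hp' i trivial).2
  · gcongr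
    linarith

theorem IsAdmissible.le_measure_sublevel (he : IsAdmissible e) :
    ∃ c : ℝ, 0 < c ∧ ∀ v : ℝ, 0 < v →
      ENNReal.ofReal (c * min v 1 ^ ((d : ℝ) / 2)) ≤ torusMeasure d {p | e p < v} := by
  obtain ⟨M, hM0, hM⟩ := he.isMorse.exists_norm_fderiv_fderiv_le
  obtain ⟨p, hp⟩ := he.exists_eq_zero
  choose q hq using fun i => QuotientAddGroup.mk_surjective (p i)
  have hqp : (fun i => (q i : AddCircle (2 * Real.pi))) = p := funext hq
  have hq0 : periodicLift e q = 0 := by rw [periodicLift, hqp, hp]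
  have hD0 : fderiv ℝ (periodicLift e) q = 0 := by
    have h := sq_norm_fderiv_le he.isMorse.contDiff (fun p => he.nonneg _) hM0 hM q
    rw [hq0, mul_zero] at h
    exact norm_eq_zero.mp (pow_eq_zero_iff (n := 2) (by norm_num) |>.mp
      (le_antisymm h (by positivity)))
  -- With M' ≥ 1 the radius `s` is at most 1 < π, so the ball around the zero fits into the
  -- fundamental cube centred there.
  set M' := M + 1 with hM'
  have hM'0 : 0 < M' := by positivity
  refine ⟨((2 * Real.pi)⁻¹ * 2) ^ d * (1 / M') ^ ((d : ℝ) / 2),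
    by have := Real.pi_pos; positivity, fun v hv => ?_⟩
  set w := min v 1 with hw
  have hw0 : 0 < w := lt_min hv one_pos
  set s := Real.sqrt (1 / M' * w) with hs
  have hs0 : 0 < s := by positivity
  have hs1 : s ≤ 1 := by
    rw [hs, Real.sqrt_le_one]
    have : 1 / M' ≤ 1 := by rw [div_le_one hM'0]; linarith
    exact mul_le_one₀ this hw0.le (min_le_right _ _)
  rw [torusMeasure_apply (fun i => q i - Real.pi)
    (measurableSet_lt e.continuous.measurable measurable_const)]
  have hball : volume (Metric.ball q s) ≤ volume ({p : Fin d → ℝ |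
      (fun i => (p i : AddCircle (2 * Real.pi))) ∈ {p | e p < v}} ∩
        Set.pi Set.univ fun i => Set.Ioc (q i - Real.pi) (q i - Real.pi + 2 * Real.pi)) := by
    refine measure_mono fun x hx => ⟨?_, fun i _ => ?_⟩
    · have h := le_taylor_of_norm_fderiv_fderiv_le he.isMorse.contDiff hM q (x - q)
      rw [add_sub_cancel, hq0, hD0] at h
      simp only [_root_.zero_apply, add_zero, zero_add] at h
      refine h.trans_lt ?_
      rw [Metric.mem_ball, dist_eq_norm, hs, Real.lt_sqrt (norm_nonneg _), one_div_mul_eq_div,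
        lt_div_iff₀ hM'0] at hx
      have : w ≤ v := min_le_left _ _
      nlinarith [sq_nonneg ‖x - q‖]
    · have h := (dist_le_pi_dist x q i).trans_lt hx
      rw [Real.dist_eq, abs_lt] at h
      have := Real.pi_gt_three
      constructor <;> linarith [h.1, h.2]
  refine le_trans (le_of_eq ?_) (mul_le_mul_right hball _)
  rw [Real.volume_pi_ball q hs0, Fintype.card_fin, ← ENNReal.ofReal_inv_of_pos Real.two_pi_pos,
    ← ENNReal.ofReal_pow (by have := Real.pi_pos; positivity),
    ← ENNReal.ofReal_mul (by have := Real.pi_pos; positivity)]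
  congr 1
  have hsd : s ^ d = (1 / M') ^ ((d : ℝ) / 2) * w ^ ((d : ℝ) / 2) := by
    rw [hs, ← Real.mul_rpow (by positivity) hw0.le, Real.sqrt_eq_rpow, ← Real.rpow_natCast,
      ← Real.rpow_mul (by positivity)]
    congr 1; ring
  rw [mul_pow, mul_pow, hsd]
  ring

theorem IsAdmissible.ae_pos (hd : 0 < d) (he : IsAdmissible e) :
    ∀ᵐ p ∂torusMeasure d, 0 < e p := by
  obtain ⟨C, hC0, hC⟩ := he.measure_sublevel_le
  have hlim : Tendsto (fun v : ℝ => ENNReal.ofReal (C * v ^ ((d : ℝ) / 2))) (𝓝[>] 0) (𝓝 0) := by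
    have h : ContinuousAt (fun v : ℝ => ENNReal.ofReal (C * v ^ ((d : ℝ) / 2))) 0 := by
      refine ENNReal.continuous_ofReal.continuousAt.comp (ContinuousAt.mul continuousAt_const ?_)
      exact Real.continuousAt_rpow_const _ _ (Or.inr (by positivity))
    have h2 := h.tendsto.mono_left (nhdsWithin_le_nhds (s := Set.Ioi 0))
    rwa [Real.zero_rpow (by positivity), mul_zero, ENNReal.ofReal_zero] at h2
  rw [ae_iff]
  refine le_antisymm (ge_of_tendsto hlim ?_) bot_le
  filter_upwards [self_mem_nhdsWithin] with v hv
  refine (measure_mono fun p hp => ?_).trans (hC v hv)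
  have h1 : ¬ 0 < e p := hp
  have h2 : (0 : ℝ) < v := hv
  show e p < v
  linarith

/-- Dyadic shells E 2^{-k-1} < e ≤ E 2^{-k}: each contributes of order (E 2^{-k})^{d/2-1}, and the
series is geometric because d/2 > 1. -/
theorem IsAdmissible.lintegral_inv_le (hd : 3 ≤ d) (he : IsAdmissible e) :
    ∃ C : ℝ, 0 < C ∧ ∀ E : ℝ, 0 < E →
      ∫⁻ p in {p | e p ≤ E}, ENNReal.ofReal (e p)⁻¹ ∂torusMeasure d
        ≤ ENNReal.ofReal (C * E ^ ((d : ℝ) / 2 - 1)) := by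
  obtain ⟨C, hC0, hC⟩ := he.measure_sublevel_le
  set a := (d : ℝ) / 2 with ha
  have ha1 : 1 < a := by
    have : (3 : ℝ) ≤ d := by exact_mod_cast hd
    rw [ha]; linarith
  set ρ : ℝ := (1 / 2) ^ (a - 1) with hρ
  have hρ0 : 0 < ρ := by positivity
  have hρ1 : ρ < 1 := Real.rpow_lt_one (by norm_num) (by norm_num) (by linarith)
  have h1ρ : 0 < 1 - ρ := by linarith
  refine ⟨2 * (C * 2 ^ a) * (1 - ρ)⁻¹, by positivity, fun E hE => ?_⟩
  have hmeas : ∀ v, MeasurableSet {p | e p ≤ v} := fun v =>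
    measurableSet_le e.continuous.measurable measurable_const
  rw [← lintegral_indicator (hmeas E)]
  have hpt : ∀ p, Set.indicator {p | e p ≤ E} (fun p => ENNReal.ofReal (e p)⁻¹) p ≤
      ∑' k : ℕ, Set.indicator {p | e p ≤ E * (1 / 2) ^ k}
        (fun _ => ENNReal.ofReal (2 * (E * (1 / 2) ^ k)⁻¹)) p := by
    intro p
    by_cases hp : e p ≤ E
    swap
    · simp [Set.indicator_of_notMem (s := {p | e p ≤ E}) hp]
    -- On the zero set the integrand is 0, since `0⁻¹ = 0`.
    rcases (he.nonneg p).eq_or_lt with h0 | h0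
    · simp [Set.indicator, ← h0]
    obtain ⟨k, hk1, hk2⟩ := exists_nat_pow_near_of_lt_one (x := e p / E) (y := 1 / 2) (by positivity)
      (by rwa [div_le_one hE]) (by norm_num) (by norm_num)
    rw [div_le_iff₀ hE, mul_comm _ E] at hk2
    rw [lt_div_iff₀ hE, pow_succ] at hk1
    refine le_trans ?_ (ENNReal.le_tsum k)
    rw [Set.indicator_of_mem (s := {p | e p ≤ E}) hp,
      Set.indicator_of_mem (s := {p | e p ≤ E * (1 / 2) ^ k}) hk2]
    refine ENNReal.ofReal_le_ofReal ?_
    rw [inv_le_comm₀ h0 (by positivity), mul_inv, inv_inv]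
    linarith
  refine (lintegral_mono hpt).trans ?_
  rw [lintegral_tsum fun k => (measurable_const.indicator (hmeas _)).aemeasurable]
  have hk : ∀ k : ℕ, ∫⁻ p, Set.indicator {p | e p ≤ E * (1 / 2) ^ k}
        (fun _ => ENNReal.ofReal (2 * (E * (1 / 2) ^ k)⁻¹)) p ∂torusMeasure d
      ≤ ENNReal.ofReal (2 * (C * 2 ^ a) * E ^ (a - 1) * ρ ^ k) := by
    intro k
    have hv : 0 < E * (1 / 2) ^ k := by positivity
    rw [lintegral_indicator_const (hmeas _)]
    -- The measure bound concerns strict sublevel sets; doubling the level covers the closed one and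
    -- produces the factor `2 ^ a`.
    calc _ ≤ ENNReal.ofReal (2 * (E * (1 / 2) ^ k)⁻¹) *
          ENNReal.ofReal (C * (2 * (E * (1 / 2) ^ k)) ^ a) := by
            gcongr
            refine (measure_mono fun p hp => ?_).trans (hC _ (by positivity))
            have : e p ≤ E * (1 / 2) ^ k := hp
            show e p < _
            linarith
      _ = _ := by
            rw [← ENNReal.ofReal_mul (by positivity)]
            congr 1
            have h1 : ρ ^ k = ((1 / 2 : ℝ) ^ k) ^ (a - 1) := by
              rw [hρ, ← Real.rpow_natCast, ← Real.rpow_natCast, ← Real.rpow_mul (by norm_num),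
                ← Real.rpow_mul (by norm_num), mul_comm]
            have h2 : E ^ (a - 1) * ρ ^ k = (E * (1 / 2) ^ k) ^ a * (E * (1 / 2) ^ k)⁻¹ := by
              rw [h1, ← Real.mul_rpow hE.le (by positivity), Real.rpow_sub_one hv.ne',
                div_eq_mul_inv]
            rw [mul_assoc _ _ (ρ ^ k), h2, Real.mul_rpow (by norm_num) hv.le]
            ring
  refine (ENNReal.tsum_le_tsum hk).trans ?_
  rw [← ENNReal.ofReal_tsum_of_nonneg (fun k => by positivity)
    ((summable_geometric_of_lt_one hρ0.le hρ1).mul_left _), tsum_mul_left,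
    tsum_geometric_of_lt_one hρ0.le hρ1]
  exact ENNReal.ofReal_le_ofReal (le_of_eq (by ring))

end LatticeSchrodinger

/-! ### Ranks of independent families of subspaces -/

section Rank

variable {K M ι : Type} [DivisionRing K] [AddCommGroup M] [Module K M] {p : ι → Submodule K M}

theorem iSupIndep.toENat_rank_iSup_finset (h : iSupIndep p) (s : Finset ι) :
    (Module.rank K ↥(⨆ i ∈ s, p i)).toENat = ∑ i ∈ s, (Module.rank K (p i)).toENat := by
  classical
  induction s using Finset.induction_on with
  | empty => simp
  | insert a s ha ih =>
    have hdisj : p a ⊓ (⨆ i ∈ s, p i) = ⊥ :=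
      ((h a).mono_right (iSup₂_le fun i hi => le_iSup₂_of_le i
        (by rintro rfl; exact ha hi) le_rfl)).eq_bot
    have hr := Submodule.rank_sup_add_rank_inf_eq (p a) (⨆ i ∈ s, p i)
    rw [hdisj, rank_bot, add_zero] at hr
    rw [Finset.iSup_insert, hr, map_add, ih, Finset.sum_insert ha]

/-- If the sum is finite, only finitely many subspaces are nonzero and the finite case applies to
their supremum. This turns the eigenvalue count into the rank of one subspace. -/
theorem iSupIndep.tsum_toENat_rank (h : iSupIndep p) :
    ∑' i, ((Module.rank K (p i)).toENat : ℝ≥0∞)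
      = ((Module.rank K ↥(⨆ i, p i)).toENat : ℝ≥0∞) := by
  have hs : ∀ s : Finset ι, ∑ i ∈ s, ((Module.rank K (p i)).toENat : ℝ≥0∞)
      = ((Module.rank K ↥(⨆ i ∈ s, p i)).toENat : ℝ≥0∞) := fun s => by
    rw [h.toENat_rank_iSup_finset]
    exact (map_sum ENat.toENNRealRingHom _ _).symm
  refine le_antisymm ?_ ?_
  · rw [ENNReal.tsum_eq_iSup_sum]
    refine iSup_le fun s => ?_
    rw [hs, ENat.toENNReal_le]
    refine OrderHomClass.mono Cardinal.toENat (Submodule.rank_mono ?_)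
    exact iSup₂_le fun i _ => le_iSup p i
  · by_cases htop : ∑' i, ((Module.rank K (p i)).toENat : ℝ≥0∞) = ∞
    · rw [htop]; exact le_top
    have hfin := ENNReal.finite_const_le_of_tsum_ne_top htop one_ne_zero
    refine le_trans ?_ (ENNReal.sum_le_tsum hfin.toFinset)
    rw [hs, ENat.toENNReal_le]
    refine OrderHomClass.mono Cardinal.toENat (Submodule.rank_mono ?_)
    refine iSup_le fun i => ?_
    by_cases hi : i ∈ hfin.toFinset
    · exact le_iSup₂_of_le i hi le_rfl
    · have h1 : ((Module.rank K (p i)).toENat : ℝ≥0∞) < 1 := by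
        simpa using hi
      have h2 : (Module.rank K (p i)).toENat < 1 := by
        rw [← ENat.toENNReal_lt]; simpa using h1
      have h3 : Module.rank K (p i) = 0 := by
        rw [Order.lt_one_iff, Cardinal.toENat_eq_zero] at h2
        exact h2
      rw [Submodule.rank_eq_zero.mp h3]
      exact bot_le

end Rank

/-! ### Negative eigenvalues of relatively compact perturbations of nonnegative operators -/

section Spectral

variable {H : Type} [NormedAddCommGroup H] [InnerProductSpace ℂ H]

open RCLike in
theorem LinearMap.IsSymmetric.re_inner_iSup_eigenspace_nonpos {T : H →ₗ[ℂ] H} (hT : T.IsSymmetric)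
    {φ : H} (hφ : φ ∈ ⨆ E : Set.Iio (0 : ℝ), Module.End.eigenspace T ((E : ℝ) : ℂ)) :
    re (inner ℂ φ (T φ)) ≤ 0 := by
  classical
  obtain ⟨f, hf, rfl⟩ := (Submodule.mem_iSup_iff_exists_finsupp _ _).mp hφ
  have hT1 : ∀ i, T (f i) = ((i : ℝ) : ℂ) • f i := fun i =>
    Module.End.mem_eigenspace_iff.mp (hf i)
  have horth : ∀ i j, i ≠ j → inner ℂ (f i) (f j) = 0 := fun i j hij =>
    hT.orthogonalFamily_eigenspaces (i := ((i : ℝ) : ℂ)) (j := ((j : ℝ) : ℂ))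
      (by simpa [Subtype.ext_iff] using hij) ⟨f i, hf i⟩ ⟨f j, hf j⟩
  simp only [Finsupp.sum, map_sum, inner_sum, sum_inner]
  refine Finset.sum_nonpos fun i _ => Finset.sum_nonpos fun j _ => ?_
  rw [hT1, inner_smul_right]
  by_cases hij : j = i
  · subst hij
    rw [inner_self_eq_norm_sq_to_K]
    have h1 : ((j : ℝ)) ≤ 0 := le_of_lt j.2
    have h2 : (((j : ℝ) : ℂ) * ((‖f j‖ : ℝ) : ℂ) ^ 2) = (((j : ℝ) * ‖f j‖ ^ 2 : ℝ) : ℂ) := by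
      push_cast; ring
    change ((((j : ℝ) : ℂ) * ((‖f j‖ : ℝ) : ℂ) ^ 2)).re ≤ 0
    rw [h2, Complex.ofReal_re]
    exact mul_nonpos_of_nonpos_of_nonneg h1 (by positivity)
  · rw [horth _ _ hij, mul_zero]
    simp

variable [CompleteSpace H]

/-- The minimum of a negative form is attained on an invariant subspace. -/
theorem exists_hasEigenvector_of_re_inner_neg {A K : H →L[ℂ] H}
    (hA : (A : H →ₗ[ℂ] H).IsSymmetric) (hK : (K : H →ₗ[ℂ] H).IsSymmetric)
    (hA0 : ∀ φ, 0 ≤ (inner ℂ φ (A φ)).re) (hKc : IsCompactOperator K)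
    {S : Submodule ℂ H} (hSc : IsClosed (S : Set H)) (hS : ∀ φ ∈ S, (A - K) φ ∈ S)
    {φ : H} (hφS : φ ∈ S) (hφ : (inner ℂ φ ((A - K) φ)).re < 0) :
    ∃ m : ℝ, m < 0 ∧ ∃ ψ ∈ S, ψ ≠ 0 ∧ (A - K) ψ = (m : ℂ) • ψ := by
  set T := A - K with hT
  have hTs : (T : H →ₗ[ℂ] H).IsSymmetric := fun x y => by
    simp only [hT, ContinuousLinearMap.coe_coe, _root_.sub_apply, inner_sub_left,
      inner_sub_right]
    rw [show inner ℂ (A x) y = inner ℂ x (A y) from hA x y,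
      show inner ℂ (K x) y = inner ℂ x (K y) from hK x y]
  set R : Set ℝ := {r | ∃ ψ ∈ S, ‖ψ‖ = 1 ∧ (inner ℂ ψ (T ψ)).re = r} with hR
  have hbdd : BddBelow R := by
    refine ⟨-‖T‖, ?_⟩
    rintro r ⟨ψ, -, h1, rfl⟩
    have h2 : |(inner ℂ ψ (T ψ)).re| ≤ ‖T‖ := by
      refine (Complex.abs_re_le_norm _).trans ((norm_inner_le_norm _ _).trans ?_)
      simpa [h1] using T.le_opNorm ψ
    exact (abs_le.mp h2).1
  have hscale : ∀ (c : ℝ) (ψ : H), (inner ℂ ((c : ℂ) • ψ) (T ((c : ℂ) • ψ))).re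
      = c ^ 2 * (inner ℂ ψ (T ψ)).re := fun c ψ => by
    rw [map_smul, inner_smul_left, inner_smul_right, Complex.conj_ofReal, ← mul_assoc,
      ← Complex.ofReal_mul, Complex.re_ofReal_mul]
    ring
  have hmemR : ∀ ψ ∈ S, ψ ≠ 0 → (inner ℂ ψ (T ψ)).re / ‖ψ‖ ^ 2 ∈ R := fun ψ hψ h0 => by
    have hn : ‖ψ‖ ≠ 0 := norm_ne_zero_iff.mpr h0
    refine ⟨((‖ψ‖⁻¹ : ℝ) : ℂ) • ψ, S.smul_mem _ hψ, ?_, ?_⟩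
    · rw [norm_smul, Complex.norm_real, norm_inv, norm_norm, inv_mul_cancel₀ hn]
    · rw [hscale]; field_simp
  have hφ0 : φ ≠ 0 := by rintro rfl; simp at hφ
  have hne : R.Nonempty := ⟨_, hmemR φ hφS hφ0⟩
  set m := sInf R with hm
  have hm0 : m < 0 := (csInf_le hbdd (hmemR φ hφS hφ0)).trans_lt
    (div_neg_of_neg_of_pos hφ (by positivity))
  refine ⟨m, hm0, ?_⟩
  set P : H →L[ℂ] H := T - (m : ℂ) • ContinuousLinearMap.id ℂ H with hP
  have hPapp : ∀ ψ, P ψ = T ψ - (m : ℂ) • ψ := fun ψ => rfl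
  have hPinner : ∀ ψ, (inner ℂ ψ (P ψ)).re = (inner ℂ ψ (T ψ)).re - m * ‖ψ‖ ^ 2 := fun ψ => by
    rw [hPapp, inner_sub_right, inner_smul_right, inner_self_eq_norm_sq_to_K, Complex.sub_re,
      Complex.re_ofReal_mul]
    congr 2
    norm_cast
  have hPnonneg : ∀ ψ ∈ S, 0 ≤ (inner ℂ ψ (P ψ)).re := fun ψ hψ => by
    rw [hPinner]
    by_cases h0 : ψ = 0
    · simp [h0]
    have h1 := csInf_le hbdd (hmemR ψ hψ h0)
    have hn : 0 < ‖ψ‖ ^ 2 := by have := norm_pos_iff.mpr h0; positivity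
    rw [← hm, le_div_iff₀ hn] at h1
    linarith
  have hPS : ∀ ψ ∈ S, P ψ ∈ S := fun ψ hψ => S.sub_mem (hS ψ hψ) (S.smul_mem _ hψ)
  have hPs : ∀ x y, inner ℂ (P x) y = inner ℂ x (P y) := fun x y => by
    rw [hPapp, hPapp, inner_sub_left, inner_sub_right, inner_smul_left, inner_smul_right,
      Complex.conj_ofReal, show inner ℂ (T x) y = inner ℂ x (T y) from hTs x y]
  -- A Cauchy–Schwarz estimate for the nonnegative form of `P` on `S`, obtained by testing it at ψ -
  -- t P ψ. The `+ 1` keeps `t` defined when `P = 0`.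
  have hPbound : ∀ ψ ∈ S, ‖P ψ‖ ^ 2 ≤ (‖P‖ + 1) * (inner ℂ ψ (P ψ)).re := fun ψ hψ => by
    set t : ℝ := (‖P‖ + 1)⁻¹ with ht
    have hb : 0 < ‖P‖ + 1 := by positivity
    have ht0 : 0 < t := by positivity
    have h := hPnonneg (ψ - (t : ℂ) • P ψ) (S.sub_mem hψ (S.smul_mem _ (hPS ψ hψ)))
    have hself : (inner ℂ (P ψ) (P ψ)).re = ‖P ψ‖ ^ 2 := by
      rw [inner_self_eq_norm_sq_to_K]; norm_cast
    have h3 : (inner ℂ (P ψ) (P (P ψ))).re ≤ ‖P‖ * ‖P ψ‖ ^ 2 := by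
      refine (Complex.re_le_norm _).trans ((norm_inner_le_norm _ _).trans ?_)
      have := P.le_opNorm (P ψ)
      nlinarith [norm_nonneg (P ψ)]
    rw [map_sub, map_smul, inner_sub_left, inner_sub_right, inner_sub_right, inner_smul_left,
      inner_smul_right, inner_smul_left, inner_smul_right, Complex.conj_ofReal,
      ← hPs ψ (P ψ)] at h
    simp only [Complex.sub_re, Complex.re_ofReal_mul, hself] at h
    have h4 : t * ‖P‖ ≤ 1 := by
      rw [ht, inv_mul_le_iff₀ hb]; linarith
    have h5 : t * (t * (inner ℂ (P ψ) (P (P ψ))).re) ≤ t * ‖P ψ‖ ^ 2 := by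
      refine mul_le_mul_of_nonneg_left ?_ ht0.le
      calc _ ≤ t * (‖P‖ * ‖P ψ‖ ^ 2) := by gcongr
        _ = (t * ‖P‖) * ‖P ψ‖ ^ 2 := by ring
        _ ≤ 1 * ‖P ψ‖ ^ 2 := by gcongr
        _ = _ := one_mul _
    have h6 : t * ‖P ψ‖ ^ 2 ≤ (inner ℂ ψ (P ψ)).re := by linarith
    rwa [ht, inv_mul_le_iff₀ hb] at h6
  -- a minimizing sequence
  have hseq : ∀ n : ℕ, ∃ ψ ∈ S, ‖ψ‖ = 1 ∧ (inner ℂ ψ (T ψ)).re < m + 1 / ((n : ℝ) + 1) := fun n => by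
    obtain ⟨r, ⟨ψ, h1, h2, rfl⟩, h3⟩ := exists_lt_of_csInf_lt hne
      (show sInf R < m + 1 / ((n : ℝ) + 1) by rw [← hm]; linarith [Nat.one_div_pos_of_nat (α := ℝ) (n := n)])
    exact ⟨ψ, h1, h2, h3⟩
  choose ψ hψS hψ1 hψT using hseq
  have hPlim : Tendsto (fun n => P (ψ n)) atTop (𝓝 0) := by
    have h1 : Tendsto (fun n : ℕ => (‖P‖ + 1) * (1 / ((n : ℝ) + 1))) atTop (𝓝 0) := by
      simpa using tendsto_one_div_add_atTop_nhds_zero_nat.const_mul (‖P‖ + 1)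
    have h2 : Tendsto (fun n => ‖P (ψ n)‖ ^ 2) atTop (𝓝 0) := by
      refine squeeze_zero (fun n => by positivity) (fun n => ?_) h1
      refine (hPbound _ (hψS n)).trans ?_
      refine mul_le_mul_of_nonneg_left ?_ (by positivity)
      rw [hPinner, hψ1]
      have := hψT n
      linarith
    rw [tendsto_zero_iff_norm_tendsto_zero]
    have h3 := h2.sqrt
    simpa [Real.sqrt_sq (norm_nonneg _)] using h3
  -- compactness
  obtain ⟨χ, -, g, hg, hKlim⟩ := (hKc.isCompact_closure_image_closedBall (f := (K : H →ₗ[ℂ] H)) 1).tendsto_subseq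
    (x := fun n => K (ψ n)) fun n => subset_closure ⟨ψ n, by simp [hψ1], rfl⟩
  -- Since A ≥ 0 and m < 0, `B` is bounded below by -m. Convergence of B ψₙ = P ψₙ + K ψₙ along the
  -- subsequence therefore forces ψₙ itself to converge.
  set B : H →L[ℂ] H := A - (m : ℂ) • ContinuousLinearMap.id ℂ H with hB
  have hBlim : Tendsto (fun n => B (ψ (g n))) atTop (𝓝 χ) := by
    have h := (hPlim.comp hg.tendsto_atTop).add hKlim
    rw [zero_add] at h
    refine h.congr fun n => ?_
    simp only [Function.comp_apply, hP, hB, hT, _root_.sub_apply]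
    abel
  have hBbound : ∀ x, -m * ‖x‖ ≤ ‖B x‖ := fun x => by
    by_cases hx : x = 0
    · simp [hx]
    have hx' : 0 < ‖x‖ := norm_pos_iff.mpr hx
    have h1 : (inner ℂ x (B x)).re = (inner ℂ x (A x)).re - m * ‖x‖ ^ 2 := by
      rw [show B x = A x - (m : ℂ) • x from rfl, inner_sub_right, inner_smul_right,
        inner_self_eq_norm_sq_to_K, Complex.sub_re, Complex.re_ofReal_mul]
      congr 2
      norm_cast
    have h2 : (inner ℂ x (B x)).re ≤ ‖x‖ * ‖B x‖ :=
      (Complex.re_le_norm _).trans (norm_inner_le_norm _ _)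
    have h3 := hA0 x
    have h4 : ‖x‖ * (-m * ‖x‖) ≤ ‖x‖ * ‖B x‖ := by nlinarith
    exact le_of_mul_le_mul_left h4 hx'
  have hcauchy : CauchySeq fun n => ψ (g n) := by
    have hanti : AntilipschitzWith (Real.toNNReal (-m)⁻¹) B := by
      refine B.antilipschitz_of_bound fun x => ?_
      rw [Real.coe_toNNReal _ (by rw [inv_nonneg]; linarith), inv_mul_eq_div, le_div_iff₀ (by linarith),
        mul_comm]
      exact hBbound x
    exact ((hanti.isUniformInducing B.uniformContinuous).cauchy_map_iff (F := map _ atTop)).mp hBlim.cauchySeq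
  obtain ⟨η, hη⟩ := cauchySeq_tendsto_of_complete hcauchy
  have hη1 : ‖η‖ = 1 := tendsto_nhds_unique hη.norm (by simp [hψ1])
  refine ⟨η, hSc.mem_of_tendsto hη (Eventually.of_forall fun n => hψS _), ?_, ?_⟩
  · rintro rfl; simp at hη1
  · have h1 : Tendsto (fun n => P (ψ (g n))) atTop (𝓝 (P η)) := (P.continuous.tendsto η).comp hη
    have h2 := tendsto_nhds_unique h1 (hPlim.comp hg.tendsto_atTop)
    rw [hPapp, sub_eq_zero] at h2
    exact h2

/-- If `W` were larger than the span `U` of the negative eigenspaces, it would meet Uᗮ. The form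
then takes a negative value on this invariant subspace, which yields a negative eigenvector in both
`U` and Uᗮ. -/
theorem finrank_le_toENat_rank_iSup_eigenspace {A K : H →L[ℂ] H}
    (hA : (A : H →ₗ[ℂ] H).IsSymmetric) (hK : (K : H →ₗ[ℂ] H).IsSymmetric)
    (hA0 : ∀ φ, 0 ≤ (inner ℂ φ (A φ)).re) (hKc : IsCompactOperator K)
    (W : Submodule ℂ H) [FiniteDimensional ℂ W]
    (hW : ∀ φ ∈ W, φ ≠ 0 → (inner ℂ φ ((A - K) φ)).re < 0) :
    (Module.finrank ℂ W : ℕ∞) ≤ (Module.rank ℂ ↥(⨆ E : Set.Iio (0 : ℝ),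
      Module.End.eigenspace ((A - K : H →L[ℂ] H) : H →ₗ[ℂ] H) ((E : ℝ) : ℂ))).toENat := by
  set U := ⨆ E : Set.Iio (0 : ℝ),
      Module.End.eigenspace ((A - K : H →L[ℂ] H) : H →ₗ[ℂ] H) ((E : ℝ) : ℂ) with hU
  by_contra hlt
  rw [not_le] at hlt
  have hfin : Module.rank ℂ U < Cardinal.aleph0 := by
    rw [← Cardinal.toENat_lt_top]
    exact hlt.trans (ENat.natCast_lt_top _)
  have hUfd : FiniteDimensional ℂ U := Module.rank_lt_aleph0_iff.mp hfin
  rw [← Module.finrank_eq_rank, Cardinal.toENat_nat, Nat.cast_lt] at hlt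
  have hTs : ((A - K : H →L[ℂ] H) : H →ₗ[ℂ] H).IsSymmetric := fun x y => by
    simp only [ContinuousLinearMap.coe_coe, _root_.sub_apply, inner_sub_left,
      inner_sub_right]
    rw [show inner ℂ (A x) y = inner ℂ x (A y) from hA x y,
      show inner ℂ (K x) y = inner ℂ x (K y) from hK x y]
  obtain ⟨w, hw, hw0⟩ : ∃ w : W, w ∈ LinearMap.ker
      ((U.orthogonalProjectionOnto : H →ₗ[ℂ] U).comp W.subtype) ∧ w ≠ 0 := by
    have := LinearMap.ker_ne_bot_of_finrank_lt
      (f := ((U.orthogonalProjectionOnto : H →ₗ[ℂ] U).comp W.subtype)) hlt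
    exact (Submodule.ne_bot_iff _).mp this
  have hwU : (w : H) ∈ Uᗮ := by
    rw [← Submodule.orthogonalProjectionOnto_eq_zero_iff]
    exact hw
  have hUinv : ∀ φ ∈ U, (A - K) φ ∈ U := by
    intro φ hφ
    have : U ≤ U.comap ((A - K : H →L[ℂ] H) : H →ₗ[ℂ] H) := by
      refine iSup_le fun E x hx => ?_
      have h1 := Module.End.mem_eigenspace_iff.mp hx
      have h2 : x ∈ U := (le_iSup (fun E : Set.Iio (0 : ℝ) =>
        Module.End.eigenspace ((A - K : H →L[ℂ] H) : H →ₗ[ℂ] H) ((E : ℝ) : ℂ)) E) hx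
      rw [Submodule.mem_comap, h1]
      exact U.smul_mem _ h2
    exact this hφ
  obtain ⟨m, hm, ψ, hψ, hψ0, hψT⟩ := exists_hasEigenvector_of_re_inner_neg hA hK hA0 hKc
    (S := Uᗮ) U.isClosed_orthogonal (fun φ hφ => by
      rw [Submodule.mem_orthogonal] at hφ ⊢
      intro u hu
      rw [← show inner ℂ ((A - K) u) φ = inner ℂ u ((A - K) φ) from hTs u φ]
      exact hφ _ (hUinv u hu)) hwU (hW w w.2 (by simpa using hw0))
  have hψU : ψ ∈ U := (le_iSup (fun E : Set.Iio (0 : ℝ) =>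
        Module.End.eigenspace ((A - K : H →L[ℂ] H) : H →ₗ[ℂ] H) ((E : ℝ) : ℂ)) ⟨m, hm⟩)
    (Module.End.mem_eigenspace_iff.mpr hψT)
  exact hψ0 (inner_self_eq_zero.mp ((Submodule.mem_orthogonal _ _).mp hψ ψ hψU))

end Spectral

namespace LatticeSchrodinger

/-! ### The quadratic forms of the hopping matrix and of the potential -/

section Operators

variable {d : ℕ}

theorem norm_sq_eq_integral (f : Lp ℂ 2 (torusMeasure d)) :
    ‖f‖ ^ 2 = ∫ p, ‖f p‖ ^ 2 ∂torusMeasure d := by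
  have h : ((‖f‖ ^ 2 : ℝ) : ℂ) = ((∫ p, ‖f p‖ ^ 2 ∂torusMeasure d : ℝ) : ℂ) := by
    rw [← integral_complex_ofReal]
    have h1 := (L2.inner_def (𝕜 := ℂ) f f).symm
    simp_rw [inner_self_eq_norm_sq_to_K] at h1
    push_cast
    exact_mod_cast h1.symm
  exact_mod_cast h

theorem integrable_norm_sq (f : Lp ℂ 2 (torusMeasure d)) :
    Integrable (fun p => ‖f p‖ ^ 2) (torusMeasure d) :=
  (memLp_two_iff_integrable_sq_norm (Lp.aestronglyMeasurable f)).mp (Lp.memLp f)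

theorem coeFn_torusMul (e : C(Torus d, ℝ)) (g : Lp ℂ 2 (torusMeasure d)) :
    torusMul e g =ᵐ[torusMeasure d] fun p => (e p : ℂ) * g p := by
  have h1 := ContinuousLinearMap.coeFn_holder (r := 2) (ContinuousLinearMap.mul ℂ ℂ)
    (ContinuousMap.toLp ∞ (torusMeasure d) ℂ
      ((⟨Complex.ofReal, Complex.continuous_ofReal⟩ : C(ℝ, ℂ)).comp e)) g
  have h2 := ContinuousMap.coeFn_toLp (p := ∞) (𝕜 := ℂ) (torusMeasure d)
    ((⟨Complex.ofReal, Complex.continuous_ofReal⟩ : C(ℝ, ℂ)).comp e)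
  filter_upwards [h1, h2] with p h1 h2
  have : torusMul e g p = (ContinuousLinearMap.mul ℂ ℂ)
    ((ContinuousMap.toLp ∞ (torusMeasure d) ℂ
      ((⟨Complex.ofReal, Complex.continuous_ofReal⟩ : C(ℝ, ℂ)).comp e)) p) (g p) := h1
  rw [this, h2]
  rfl

theorem inner_torusMul_left (e : C(Torus d, ℝ)) (f g : Lp ℂ 2 (torusMeasure d)) :
    inner ℂ (torusMul e f) g = inner ℂ f (torusMul e g) := by
  rw [L2.inner_def, L2.inner_def]
  refine integral_congr_ae ?_
  filter_upwards [coeFn_torusMul e f, coeFn_torusMul e g] with p h1 h2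
  rw [h1, h2]
  simp only [RCLike.inner_apply, map_mul, Complex.conj_ofReal]
  ring

theorem inner_hopping (e : C(Torus d, ℝ)) (φ ψ : HilbertSpace d) :
    inner ℂ φ (hopping e ψ) = inner ℂ (fourierStar d φ) (torusMul e (fourierStar d ψ)) := by
  simp only [hopping, ContinuousLinearMap.comp_apply]
  rw [ContinuousLinearMap.adjoint_inner_right]
  rfl

theorem hopping_isSymmetric (e : C(Torus d, ℝ)) :
    (hopping e : HilbertSpace d →ₗ[ℂ] HilbertSpace d).IsSymmetric := fun φ ψ => by
  simp only [ContinuousLinearMap.coe_coe]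
  rw [inner_hopping, ← inner_conj_symm, inner_hopping, inner_conj_symm, inner_torusMul_left]

theorem re_inner_torusMul (e : C(Torus d, ℝ)) (f : Lp ℂ 2 (torusMeasure d)) :
    (inner ℂ f (torusMul e f)).re = ∫ p, e p * ‖f p‖ ^ 2 ∂torusMeasure d := by
  have h : inner ℂ f (torusMul e f) = ((∫ p, e p * ‖f p‖ ^ 2 ∂torusMeasure d : ℝ) : ℂ) := by
    rw [← integral_complex_ofReal, L2.inner_def]
    refine integral_congr_ae ?_
    filter_upwards [coeFn_torusMul e f] with p h1
    rw [h1, RCLike.inner_apply, mul_assoc, Complex.mul_conj']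
    push_cast
    rfl
  rw [h, Complex.ofReal_re]

theorem integrable_mul_norm_sq (e : C(Torus d, ℝ)) (f : Lp ℂ 2 (torusMeasure d)) :
    Integrable (fun p => e p * ‖f p‖ ^ 2) (torusMeasure d) :=
  (integrable_norm_sq f).bdd_mul e.continuous.aestronglyMeasurable
    (Eventually.of_forall fun p => e.norm_coe_le_norm p)

theorem re_inner_hopping (e : C(Torus d, ℝ)) (φ : HilbertSpace d) :
    (inner ℂ φ (hopping e φ)).re = ∫ p, e p * ‖fourierStar d φ p‖ ^ 2 ∂torusMeasure d := by
  rw [inner_hopping, re_inner_torusMul]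

theorem fourierStar_single (x : IntLattice d) :
    fourierStar d (lp.single 2 x (1 : ℂ)) = characterLp x := by
  rw [fourierStar, OrthogonalFamily.linearIsometry_apply_single]
  simp

theorem inner_characterLp_fourierStar (x : IntLattice d) (φ : HilbertSpace d) :
    inner ℂ (characterLp x) (fourierStar d φ) = φ x := by
  rw [← fourierStar_single, LinearIsometry.inner_map_map, lp.inner_single_left]
  simp

theorem potentialMul_apply (V : Potential d) (φ : HilbertSpace d) (x : IntLattice d) :
    potentialMul V φ x = (V x : ℂ) * φ x := rfl

theorem potentialMul_isSymmetric (V : Potential d) :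
    (potentialMul V : HilbertSpace d →ₗ[ℂ] HilbertSpace d).IsSymmetric := fun φ ψ => by
  simp only [ContinuousLinearMap.coe_coe]
  rw [lp.inner_eq_tsum, lp.inner_eq_tsum]
  refine tsum_congr fun x => ?_
  simp only [potentialMul_apply, RCLike.inner_apply, map_mul, Complex.conj_ofReal]
  ring

theorem hasSum_re_inner_potentialMul (V : Potential d) (φ : HilbertSpace d) :
    HasSum (fun x => V x * ‖φ x‖ ^ 2) (inner ℂ φ (potentialMul V φ)).re := by
  have h := Complex.hasSum_re (lp.hasSum_inner φ (potentialMul V φ))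
  have hfun : (fun x => V x * ‖φ x‖ ^ 2)
      = fun x => (inner ℂ (φ x) (potentialMul V φ x)).re := by
    funext x
    rw [potentialMul_apply, RCLike.inner_apply, mul_assoc, Complex.mul_conj', ← Complex.ofReal_pow,
      ← Complex.ofReal_mul, Complex.ofReal_re]
  rwa [hfun]

theorem hasSum_norm_sq (φ : HilbertSpace d) : HasSum (fun x => ‖φ x‖ ^ 2) (‖φ‖ ^ 2) := by
  have := lp.hasSum_norm (p := 2) (by norm_num) φ
  simpa using this

/-- Truncations of V to finite sets have finite rank and converge in norm because V vanishes at
infinity. -/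
theorem isCompactOperator_potentialMul {V : Potential d}
    (hV : Tendsto (V : IntLattice d → ℝ) cofinite (𝓝 0)) : IsCompactOperator (potentialMul V) := by
  classical
  set R : Finset (IntLattice d) → HilbertSpace d →L[ℂ] HilbertSpace d := fun S => ∑ x ∈ S,
    (innerSL ℂ (lp.single 2 x (1 : ℂ) : HilbertSpace d)).smulRight
      ((V x : ℂ) • (lp.single 2 x (1 : ℂ) : HilbertSpace d)) with hR
  have hRc : ∀ S, IsCompactOperator (R S) := fun S => by
    refine Submodule.sum_mem (compactOperator (RingHom.id ℂ) (HilbertSpace d) (HilbertSpace d))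
      (f := fun x => ((innerSL ℂ (lp.single 2 x (1 : ℂ) : HilbertSpace d)).smulRight
      ((V x : ℂ) • (lp.single 2 x (1 : ℂ) : HilbertSpace d)) :
        HilbertSpace d →L[ℂ] HilbertSpace d)) (t := S) fun x _ => ?_
    have hc : IsCompactOperator (innerSL ℂ (lp.single 2 x (1 : ℂ) : HilbertSpace d)) :=
      isCompactOperator_of_locallyCompactSpace_dom _
    exact hc.clm_comp
        (ContinuousLinearMap.toSpanSingleton ℂ ((V x : ℂ) • (lp.single 2 x (1 : ℂ) : HilbertSpace d)))
  have hRapp : ∀ S φ y, R S φ y = if y ∈ S then (V y : ℂ) * φ y else 0 := fun S φ y => by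
    simp only [hR, _root_.sum_apply, ContinuousLinearMap.smulRight_apply,
      innerSL_apply_apply, lp.inner_single_left, lp.coeFn_sum, Finset.sum_apply, lp.coeFn_smul,
      Pi.smul_apply, lp.single_apply, smul_eq_mul]
    simp [Pi.single_apply, mul_comm]
  refine isCompactOperator_of_tendsto (l := atTop) (F := R) ?_ (Eventually.of_forall hRc)
  rw [Metric.tendsto_atTop]
  intro ε hε
  have hfin : {x | ¬ |V x| < ε / 2}.Finite := by
    have := (Metric.tendsto_nhds.mp hV) (ε / 2) (by positivity)
    simpa [Filter.Eventually, mem_cofinite, Set.compl_def] using this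
  refine ⟨hfin.toFinset, fun S hS => ?_⟩
  rw [dist_eq_norm]
  refine lt_of_le_of_lt (ContinuousLinearMap.opNorm_le_bound _ (half_pos hε).le fun φ => ?_)
    (half_lt_self hε)
  have h := lp.norm_mono (p := 2) (by simp) (x := (R S - potentialMul V) φ)
    (y := ((ε / 2 : ℝ) : ℂ) • φ) fun y => ?_
  · rwa [norm_smul, Complex.norm_real, Real.norm_of_nonneg (half_pos hε).le] at h
  · have h1 : ((R S - potentialMul V) φ) y = R S φ y - (V y : ℂ) * φ y := rfl
    rw [h1, hRapp, lp.coeFn_smul, Pi.smul_apply, smul_eq_mul, norm_mul, Complex.norm_real,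
      Real.norm_of_nonneg (half_pos hε).le]
    split_ifs with hy
    · simp only [sub_self, norm_zero]; positivity
    · rw [zero_sub, norm_neg, norm_mul, Complex.norm_real]
      have : |V y| < ε / 2 := by
        by_contra hcon
        exact hy (hS (by simpa using hcon))
      gcongr
      exact this.le

/-! ### Counting negative eigenvalues variationally -/

theorem boundStates_eq (e : C(Torus d, ℝ)) (V : Potential d) :
    boundStates e V = ((Module.rank ℂ ↥(⨆ E : Set.Iio (0 : ℝ), Module.End.eigenspace
      (schrodinger e V : HilbertSpace d →ₗ[ℂ] HilbertSpace d) ((E : ℝ) : ℂ))).toENat : ℝ≥0∞) :=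
  iSupIndep.tsum_toENat_rank ((Module.End.eigenspaces_iSupIndep
    (schrodinger e V : HilbertSpace d →ₗ[ℂ] HilbertSpace d)).comp
      (f := fun E : Set.Iio (0 : ℝ) => ((E : ℝ) : ℂ))
      fun _ _ h => Subtype.ext (Complex.ofReal_injective h))

theorem schrodinger_isSymmetric (e : C(Torus d, ℝ)) (V : Potential d) :
    (schrodinger e V : HilbertSpace d →ₗ[ℂ] HilbertSpace d).IsSymmetric :=
  (hopping_isSymmetric e).sub (potentialMul_isSymmetric V)

theorem re_inner_schrodinger (e : C(Torus d, ℝ)) (V : Potential d) (φ : HilbertSpace d) :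
    (inner ℂ φ (schrodinger e V φ)).re
      = (inner ℂ φ (hopping e φ)).re - ∑' x, V x * ‖φ x‖ ^ 2 := by
  rw [(hasSum_re_inner_potentialMul V φ).tsum_eq, ← Complex.sub_re, ← inner_sub_right]
  rfl

/-- Any finite independent family in the span of the negative eigenspaces spans an admissible `W`,
so the rank itself is at most `B`. -/
theorem boundStates_le {e : C(Torus d, ℝ)} {V : Potential d} {B : ℝ≥0∞}
    (hB : ∀ W : Submodule ℂ (HilbertSpace d), FiniteDimensional ℂ W →
      (∀ φ ∈ W, (inner ℂ φ (schrodinger e V φ)).re ≤ 0) → (Module.finrank ℂ W : ℝ≥0∞) ≤ B) :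
    boundStates e V ≤ B := by
  rw [boundStates_eq]
  set U := ⨆ E : Set.Iio (0 : ℝ), Module.End.eigenspace
      (schrodinger e V : HilbertSpace d →ₗ[ℂ] HilbertSpace d) ((E : ℝ) : ℂ) with hU
  by_cases htop : B = ∞
  · rw [htop]; exact le_top
  have hr : Module.rank ℂ U ≤ (⌊B.toReal⌋₊ : ℕ) := by
    refine rank_le fun s hs => ?_
    have hs' : LinearIndependent ℂ fun i : s => ((i : U) : HilbertSpace d) :=
      hs.map' U.subtype (Submodule.ker_subtype U)
    have hfin := finrank_span_eq_card hs'
    have hfd : FiniteDimensional ℂ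
        ↥(Submodule.span ℂ (Set.range fun i : s => ((i : U) : HilbertSpace d))) :=
      FiniteDimensional.span_of_finite ℂ (Set.finite_range _)
    have h := hB (Submodule.span ℂ (Set.range fun i : s => ((i : U) : HilbertSpace d))) hfd
      fun φ hφ => ?_
    · rw [hfin, Fintype.card_coe] at h
      refine Nat.le_floor ?_
      have := ENNReal.toReal_mono htop h
      simpa using this
    · refine (schrodinger_isSymmetric e V).re_inner_iSup_eigenspace_nonpos ?_
      refine Submodule.span_le.mpr ?_ hφ
      rintro _ ⟨i, rfl⟩
      exact i.1.2
  have h1 : (Module.rank ℂ U).toENat ≤ (⌊B.toReal⌋₊ : ℕ) := by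
    rwa [Cardinal.toENat_le_natCast]
  calc ((Module.rank ℂ U).toENat : ℝ≥0∞) ≤ (((⌊B.toReal⌋₊ : ℕ) : ℕ∞) : ℝ≥0∞) := by
        rwa [ENat.toENNReal_le]
    _ ≤ B := by
        rw [ENat.toENNReal_coe, ← ENNReal.ofReal_natCast]
        refine (ENNReal.ofReal_le_ofReal (Nat.floor_le ENNReal.toReal_nonneg)).trans ?_
        rw [ENNReal.ofReal_toReal htop]

theorem re_inner_hopping_nonneg {e : C(Torus d, ℝ)} (he : ∀ p, 0 ≤ e p) (φ : HilbertSpace d) :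
    0 ≤ (inner ℂ φ (hopping e φ)).re := by
  rw [re_inner_hopping]
  exact integral_nonneg fun p => mul_nonneg (he p) (by positivity)

theorem re_inner_hopping_le {e : C(Torus d, ℝ)} {m : ℝ} (he : ∀ p, e p ≤ m)
    (φ : HilbertSpace d) : (inner ℂ φ (hopping e φ)).re ≤ m * ‖φ‖ ^ 2 := by
  rw [re_inner_hopping, ← (fourierStar d).norm_map φ, norm_sq_eq_integral, ← integral_const_mul]
  refine integral_mono (integrable_mul_norm_sq e _) ((integrable_norm_sq _).const_mul m) fun p => ?_
  exact mul_le_mul_of_nonneg_right (he p) (by positivity)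

theorem finrank_le_boundStates {e : C(Torus d, ℝ)} {V : Potential d} (he : ∀ p, 0 ≤ e p)
    (hV : Tendsto (V : IntLattice d → ℝ) cofinite (𝓝 0)) (W : Submodule ℂ (HilbertSpace d))
    [FiniteDimensional ℂ W]
    (hW : ∀ φ ∈ W, φ ≠ 0 → (inner ℂ φ (schrodinger e V φ)).re < 0) :
    (Module.finrank ℂ W : ℝ≥0∞) ≤ boundStates e V := by
  rw [boundStates_eq, ← ENat.toENNReal_coe, ENat.toENNReal_le]
  exact finrank_le_toENat_rank_iSup_eigenspace (hopping_isSymmetric e) (potentialMul_isSymmetric V)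
    (re_inner_hopping_nonneg he) (isCompactOperator_potentialMul hV) W hW

/-- Every site at which the potential exceeds the hopping energy binds a state. -/
theorem card_le_boundStates {e : C(Torus d, ℝ)} {V : Potential d} (he : ∀ p, 0 ≤ e p) {m : ℝ}
    (hm : ∀ p, e p ≤ m) (hV : Tendsto (V : IntLattice d → ℝ) cofinite (𝓝 0))
    (S : Finset (IntLattice d)) (hS : ∀ x ∈ S, m < V x) :
    (S.card : ℝ≥0∞) ≤ boundStates e V := by
  classical
  set v : S → HilbertSpace d := fun x => lp.single 2 (x : IntLattice d) (1 : ℂ) with hv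
  have happ : ∀ (x : S) (y : IntLattice d), v x y = if y = x then 1 else 0 := fun x y => by
    simp [hv, lp.single_apply, Pi.single_apply]
  have hli : LinearIndependent ℂ v := by
    rw [Fintype.linearIndependent_iff]
    intro g hg x
    have h := congrArg (fun φ : HilbertSpace d => φ x) hg
    simp only [lp.coeFn_sum, Finset.sum_apply, lp.coeFn_smul, Pi.smul_apply, happ] at h
    simpa [Subtype.coe_inj] using h
  have hfd : FiniteDimensional ℂ ↥(Submodule.span ℂ (Set.range v)) :=
    FiniteDimensional.span_of_finite ℂ (Set.finite_range _)
  have h := finrank_le_boundStates he hV (Submodule.span ℂ (Set.range v)) fun φ hφ hφ0 => ?_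
  · rwa [finrank_span_eq_card hli, Fintype.card_coe] at h
  have hsupp : ∀ y ∉ S, φ y = 0 := by
    intro y hy
    have : Submodule.span ℂ (Set.range v) ≤
        LinearMap.ker (lp.evalₗ (𝕜 := ℂ) (E := fun _ : IntLattice d => ℂ) (p := 2) y) := by
      refine Submodule.span_le.mpr ?_
      rintro _ ⟨x, rfl⟩
      have : v x y = 0 := by
        rw [happ, if_neg]; rintro rfl; exact hy x.2
      exact this
    exact this hφ
  rw [re_inner_schrodinger, sub_neg]
  refine (re_inner_hopping_le hm φ).trans_lt ?_
  obtain ⟨y, hy⟩ : ∃ y, φ y ≠ 0 := by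
    by_contra! hcon
    exact hφ0 (lp.ext (funext hcon))
  have hyS : y ∈ S := by
    by_contra hcon
    exact hy (hsupp y hcon)
  refine hasSum_lt (fun x => ?_) (i := y) ?_ ((hasSum_norm_sq φ).mul_left m)
    (hasSum_re_inner_potentialMul V φ).summable.hasSum
  · by_cases hx : x ∈ S
    · exact mul_le_mul_of_nonneg_right (hS x hx).le (by positivity)
    · simp [hsupp x hx]
  · exact mul_lt_mul_of_pos_right (hS y hyS) (by have := norm_pos_iff.mpr hy; positivity)

end Operators

end LatticeSchrodinger

/-! ### Dyadic energy decomposition and the Cwikel–Lieb–Rozenblum bound -/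

theorem sum_two_zpow_le (s : Finset ℤ) : ∀ K : ℤ, (∀ k ∈ s, k ≤ K) →
    ∑ k ∈ s, (2 : ℝ) ^ k ≤ 2 ^ (K + 1) := by
  induction s using Finset.induction_on_max with
  | empty => intro K _; simp only [Finset.sum_empty]; positivity
  | insert a s has ih =>
    intro K hK
    have ha : a ≤ K := hK a (Finset.mem_insert_self _ _)
    rw [Finset.sum_insert fun h => lt_irrefl _ (has a h)]
    have h1 := ih (a - 1) fun k hk => Int.le_sub_one_of_lt (has k hk)
    rw [sub_add_cancel] at h1
    calc (2 : ℝ) ^ a + ∑ k ∈ s, (2 : ℝ) ^ k ≤ 2 ^ a + 2 ^ a := by gcongr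
      _ = 2 ^ (a + 1) := by rw [zpow_add_one₀ two_ne_zero]; ring
      _ ≤ _ := zpow_le_zpow_right₀ one_le_two (by omega)

theorem sum_filter_two_zpow_lt_le (s : Finset ℤ) {t : ℝ} (ht : 0 ≤ t) :
    ∑ k ∈ s with (2 : ℝ) ^ k < t, (2 : ℝ) ^ k ≤ 2 * t := by
  rcases (s.filter fun k => (2 : ℝ) ^ k < t).eq_empty_or_nonempty with h | h
  · rw [h, Finset.sum_empty]; positivity
  · refine (sum_two_zpow_le _ (Finset.max' _ h) fun k hk => Finset.le_max' _ k hk).trans ?_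
    have h1 := (Finset.mem_filter.mp (Finset.max'_mem _ h)).2
    rw [zpow_add_one₀ two_ne_zero]
    linarith

namespace LatticeSchrodinger

variable {d : ℕ}

/-- The restriction of a square integrable function to a measurable set. -/
noncomputable def cutoff {S : Set (Torus d)} (hS : MeasurableSet S)
    (f : Lp ℂ 2 (torusMeasure d)) : Lp ℂ 2 (torusMeasure d) :=
  ((Lp.memLp f).indicator hS).toLp _

theorem coeFn_cutoff {S : Set (Torus d)} (hS : MeasurableSet S) (f : Lp ℂ 2 (torusMeasure d)) :
    cutoff hS f =ᵐ[torusMeasure d] S.indicator f :=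
  MemLp.coeFn_toLp _

theorem measurableSet_lt_symbol (e : C(Torus d, ℝ)) (E : ℝ) : MeasurableSet {p | E < e p} :=
  measurableSet_lt measurable_const e.continuous.measurable

theorem norm_cutoff_sq {S : Set (Torus d)} (hS : MeasurableSet S) (f : Lp ℂ 2 (torusMeasure d)) :
    ‖cutoff hS f‖ ^ 2 = ∫ p, S.indicator (fun p => ‖f p‖ ^ 2) p ∂torusMeasure d := by
  rw [norm_sq_eq_integral]
  refine integral_congr_ae ?_
  filter_upwards [coeFn_cutoff hS f] with p hp
  rw [hp]
  by_cases h : p ∈ S <;> simp [h]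

/-- A dyadic layer cake in energy: pointwise, the 2^k lying below e p sum to at most 2 e p. -/
theorem sum_norm_cutoff_sq_le {e : C(Torus d, ℝ)} (he : ∀ p, 0 ≤ e p) (s : Finset ℤ)
    (f : Lp ℂ 2 (torusMeasure d)) :
    ∑ k ∈ s, (2 : ℝ) ^ k * ‖cutoff (measurableSet_lt_symbol e ((2 : ℝ) ^ k)) f‖ ^ 2
      ≤ 2 * ∫ p, e p * ‖f p‖ ^ 2 ∂torusMeasure d := by
  simp_rw [norm_cutoff_sq, ← integral_const_mul]
  have hint : ∀ k : ℤ, Integrable (fun p => (2 : ℝ) ^ k *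
      {p | (2 : ℝ) ^ k < e p}.indicator (fun p => ‖f p‖ ^ 2) p) (torusMeasure d) := fun k =>
    ((integrable_norm_sq f).indicator (measurableSet_lt_symbol e _)).const_mul _
  rw [← integral_finsetSum s fun k _ => hint k]
  refine integral_mono (integrable_finsetSum s fun k _ => hint k)
    ((integrable_mul_norm_sq e f).const_mul 2) fun p => ?_
  have h1 : ∑ k ∈ s, (2 : ℝ) ^ k * {p | (2 : ℝ) ^ k < e p}.indicator (fun p => ‖f p‖ ^ 2) p
      = (∑ k ∈ s with (2 : ℝ) ^ k < e p, (2 : ℝ) ^ k) * ‖f p‖ ^ 2 := by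
    rw [Finset.sum_filter, Finset.sum_mul]
    refine Finset.sum_congr rfl fun k _ => ?_
    by_cases h : (2 : ℝ) ^ k < e p <;> simp [Set.indicator, h]
  change ∑ k ∈ s, (2 : ℝ) ^ k * {p | (2 : ℝ) ^ k < e p}.indicator (fun p => ‖f p‖ ^ 2) p
    ≤ 2 * (e p * ‖f p‖ ^ 2)
  rw [h1, ← mul_assoc]
  exact mul_le_mul_of_nonneg_right (sum_filter_two_zpow_lt_le s (he p)) (by positivity)

/-- The square root of a symbol. -/
noncomputable def sqrtSymbol (e : C(Torus d, ℝ)) : C(Torus d, ℝ) :=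
  ⟨fun p => Real.sqrt (e p), by fun_prop⟩

/-- The operator `√e ℱ*`, whose square is the hopping matrix. -/
noncomputable def sqrtHopping (e : C(Torus d, ℝ)) : HilbertSpace d →L[ℂ] Lp ℂ 2 (torusMeasure d) :=
  (torusMul (sqrtSymbol e)).comp (fourierStar d).toContinuousLinearMap

theorem norm_sqrtHopping_sq {e : C(Torus d, ℝ)} (he : ∀ p, 0 ≤ e p) (φ : HilbertSpace d) :
    ‖sqrtHopping e φ‖ ^ 2 = (inner ℂ φ (hopping e φ)).re := by
  rw [re_inner_hopping, norm_sq_eq_integral]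
  refine integral_congr_ae ?_
  filter_upwards [coeFn_torusMul (sqrtSymbol e) (fourierStar d φ)] with p hp
  have : sqrtHopping e φ p = (Real.sqrt (e p) : ℂ) * fourierStar d φ p := hp
  rw [this, norm_mul, Complex.norm_real, mul_pow, Real.norm_eq_abs, sq_abs, Real.sq_sqrt (he p)]

/-- Makes the form of the hopping matrix an inner product, so that a basis orthonormal for it
exists. -/
theorem sqrtHopping_injective {e : C(Torus d, ℝ)} (he : ∀ᵐ p ∂torusMeasure d, 0 < e p) :
    Function.Injective (sqrtHopping e) := by
  rw [injective_iff_map_eq_zero]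
  intro φ hφ
  have h0 : fourierStar d φ = 0 := by
    rw [Lp.eq_zero_iff_ae_eq_zero]
    have h1 : torusMul (sqrtSymbol e) (fourierStar d φ) = 0 := hφ
    filter_upwards [coeFn_torusMul (sqrtSymbol e) (fourierStar d φ), he,
      Lp.eq_zero_iff_ae_eq_zero.mp h1] with p h2 h3 h4
    rw [h2] at h4
    have h5 : (Real.sqrt (e p) : ℂ) ≠ 0 := by
      exact_mod_cast (Real.sqrt_pos.mpr h3).ne'
    exact (mul_eq_zero.mp h4).resolve_left h5
  exact (fourierStar d).injective (by rw [h0, map_zero])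

theorem norm_character (x : IntLattice d) (p : Torus d) : ‖character x p‖ = 1 := by
  simp only [character, ContinuousMap.coe_mk, norm_prod, fourier_apply]
  exact Finset.prod_eq_one fun i _ => Circle.norm_coe _

/-- Splitting of the evaluation at `x` into energies above and below `E`; the low energy part is
controlled by the form of the hopping matrix. -/
theorem exists_low_energy_kernel (e : C(Torus d, ℝ)) (hpos : ∀ᵐ p ∂torusMeasure d, 0 < e p)
    {E B : ℝ} (hB : 0 ≤ B)
    (hE : ∫⁻ p in {p | e p ≤ E}, ENNReal.ofReal (e p)⁻¹ ∂torusMeasure d ≤ ENNReal.ofReal B)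
    (x : IntLattice d) :
    ∃ k : Lp ℂ 2 (torusMeasure d), ‖k‖ ^ 2 ≤ B ∧ ∀ φ : HilbertSpace d,
      φ x = inner ℂ (characterLp x) (cutoff (measurableSet_lt_symbol e E) (fourierStar d φ))
        + inner ℂ k (sqrtHopping e φ) := by
  have hmeas : MeasurableSet {p | e p ≤ E} :=
    measurableSet_le e.continuous.measurable measurable_const
  -- The factor 1/√e cancels the √e in `sqrtHopping`; the squared norm of the kernel is the integral
  -- of 1/e over low energies.
  set k0 : Torus d → ℂ := {p | e p ≤ E}.indicator
    fun p => ((Real.sqrt (e p))⁻¹ : ℂ) * character x p with hk0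
  have hk0m : Measurable k0 := by
    refine Measurable.indicator ?_ hmeas
    exact ((Complex.measurable_ofReal.comp (Real.continuous_sqrt.measurable.comp
      e.continuous.measurable)).inv).mul (character x).continuous.measurable
  have hnorm : (fun p => ‖k0 p‖ ^ 2) =ᵐ[torusMeasure d]
      {p | e p ≤ E}.indicator fun p => (e p)⁻¹ := by
    filter_upwards [hpos] with p hp
    by_cases h : e p ≤ E
    · simp only [hk0, Set.indicator, Set.mem_ofPred_eq, h, if_true]
      rw [norm_mul, norm_character, mul_one, norm_inv, Complex.norm_real, inv_pow,
        Real.norm_eq_abs, sq_abs, Real.sq_sqrt hp.le]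
    · simp [hk0, Set.indicator, h]
  have hlin : ∫⁻ p, ENNReal.ofReal (‖k0 p‖ ^ 2) ∂torusMeasure d ≤ ENNReal.ofReal B := by
    refine le_trans (le_of_eq ?_) hE
    rw [← lintegral_indicator hmeas]
    refine lintegral_congr_ae ?_
    filter_upwards [hnorm] with p hp
    rw [hp]
    by_cases h : e p ≤ E <;> simp [Set.indicator, h]
  have hint : Integrable (fun p => ‖k0 p‖ ^ 2) (torusMeasure d) := by
    refine ⟨(hk0m.norm.pow_const 2).aestronglyMeasurable, ?_⟩
    rw [hasFiniteIntegral_iff_ofReal (Eventually.of_forall fun p => by positivity)]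
    exact hlin.trans_lt ENNReal.ofReal_lt_top
  have hmem : MemLp k0 2 (torusMeasure d) :=
    (memLp_two_iff_integrable_sq_norm hk0m.aestronglyMeasurable).mpr hint
  refine ⟨hmem.toLp k0, ?_, fun φ => ?_⟩
  · rw [norm_sq_eq_integral]
    have h1 : ∫ p, ‖hmem.toLp k0 p‖ ^ 2 ∂torusMeasure d = ∫ p, ‖k0 p‖ ^ 2 ∂torusMeasure d := by
      refine integral_congr_ae ?_
      filter_upwards [hmem.coeFn_toLp] with p hp
      rw [hp]
    rw [h1, integral_eq_lintegral_of_nonneg_ae (Eventually.of_forall fun p => by positivity)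
      hint.aestronglyMeasurable]
    exact ENNReal.toReal_le_of_le_ofReal hB hlin
  · rw [← inner_characterLp_fourierStar, L2.inner_def, L2.inner_def, L2.inner_def,
      ← integral_add (L2.integrable_inner _ _) (L2.integrable_inner _ _)]
    refine integral_congr_ae ?_
    have hchar : characterLp x =ᵐ[torusMeasure d] character x :=
      ContinuousMap.coeFn_toLp (p := 2) (𝕜 := ℂ) (torusMeasure d) (character x)
    filter_upwards [hpos, hmem.coeFn_toLp, hchar,
      coeFn_cutoff (measurableSet_lt_symbol e E) (fourierStar d φ),
      coeFn_torusMul (sqrtSymbol e) (fourierStar d φ)] with p h0 h1 h2 h3 h4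
    have h5 : sqrtHopping e φ p = (Real.sqrt (e p) : ℂ) * fourierStar d φ p := h4
    rw [h1, h2, h3, h5]
    have h6 : (Real.sqrt (e p) : ℂ) ≠ 0 := by
      exact_mod_cast (Real.sqrt_pos.mpr h0).ne'
    by_cases h : e p ≤ E
    · have h' : ¬ E < e p := not_lt.mpr h
      simp only [hk0, Set.indicator, Set.mem_ofPred_eq, h, h', if_true, if_false,
        RCLike.inner_apply, map_mul, map_inv₀, Complex.conj_ofReal, zero_mul, zero_add]
      field_simp
    · have h' : E < e p := not_le.mp h
      simp [hk0, Set.indicator, h, h']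

/-- The Cwikel–Lieb–Rozenblum bound on the dimension of a space on which the form of the hopping
matrix is dominated by that of a weight `w`. -/
theorem exists_finrank_le_sum_rpow (hd : 3 ≤ d) {e : C(Torus d, ℝ)} (he : IsAdmissible e) :
    ∃ C : ℝ, 0 < C ∧ ∀ w : IntLattice d → ℝ, (∀ x, 0 ≤ w x) →
      Summable (fun x => w x ^ ((d : ℝ) / 2)) → ∀ W : Submodule ℂ (HilbertSpace d),
      FiniteDimensional ℂ W → (∀ φ ∈ W, Summable (fun x => w x * ‖φ x‖ ^ 2) ∧
        (inner ℂ φ (hopping e φ)).re ≤ ∑' x, w x * ‖φ x‖ ^ 2) →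
      (Module.finrank ℂ W : ℝ) ≤ C * ∑' x, w x ^ ((d : ℝ) / 2) := by
  obtain ⟨C, hC0, hC⟩ := he.lintegral_inv_le hd
  have hpos := he.ae_pos (by omega)
  set κ : ℝ := (d : ℝ) / 2 - 1 with hκ
  have hκ0 : 0 < κ := by
    have : (3 : ℝ) ≤ d := by exact_mod_cast hd
    rw [hκ]; linarith
  refine ⟨4 * C * 16 ^ κ, by positivity, fun w hw hsum W hWfd hW => ?_⟩
  set N := Module.finrank ℂ W with hN
  -- a basis of `W` orthonormal for the form of the hopping matrix
  set A := (sqrtHopping e : HilbertSpace d →ₗ[ℂ] Lp ℂ 2 (torusMeasure d)) with hA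
  have hfr : Module.finrank ℂ (W.map A) = N :=
    (LinearEquiv.finrank_eq (W.equivMapOfInjective A (sqrtHopping_injective hpos))).symm
  let b := (stdOrthonormalBasis ℂ (W.map A)).reindex (finCongr hfr)
  have hg : ∀ j, ∃ φ ∈ W, sqrtHopping e φ = (b j : Lp ℂ 2 (torusMeasure d)) := fun j =>
    Submodule.mem_map.mp (b j).2
  choose f hfW hfb using hg
  have hbo : Orthonormal ℂ fun j => (b j : Lp ℂ 2 (torusMeasure d)) :=
    b.orthonormal.comp_linearIsometry (W.map A).subtypeₗᵢ
  have hone : ∀ j, (inner ℂ (f j) (hopping e (f j))).re = 1 := fun j => by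
    rw [← norm_sqrtHopping_sq he.nonneg, hfb, hbo.1 j, one_pow]
  -- energy scales
  have hscale : ∀ x, ∃ k : ℤ, 8 * w x ≤ (2 : ℝ) ^ k ∧ (0 < w x → (2 : ℝ) ^ k ≤ 16 * w x) := by
    intro x
    rcases (hw x).eq_or_lt with h | h
    · exact ⟨0, by simp [← h], fun h' => absurd h h'.ne⟩
    -- The dyadic scale just above 8 w x. The factor 8 is chosen so that the high-energy part costs
    -- only half the dimension; the upper bound 16 w x keeps the low-energy part of order (w
    -- x)^{d/2}.
    · obtain ⟨n, h1, h2⟩ := exists_mem_Ioc_zpow (x := 8 * w x) (y := (2 : ℝ)) (by positivity)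
        one_lt_two
      refine ⟨n + 1, h2, fun _ => ?_⟩
      rw [zpow_add_one₀ two_ne_zero]
      linarith
  choose k hk1 hk2 using hscale
  set u : ℤ → Fin N → Lp ℂ 2 (torusMeasure d) := fun n j =>
    cutoff (measurableSet_lt_symbol e ((2 : ℝ) ^ n)) (fourierStar d (f j)) with hu
  have hpt : ∀ x, w x * ∑ j, ‖f j x‖ ^ 2 ≤
      1 / 4 * ((2 : ℝ) ^ k x * ∑ j, ‖inner ℂ (characterLp x) (u (k x) j)‖ ^ 2)
        + 2 * C * 16 ^ κ * w x ^ ((d : ℝ) / 2) := by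
    intro x
    rcases (hw x).eq_or_lt with h | h
    · rw [← h, zero_mul]
      positivity
    have hE : (0 : ℝ) < 2 ^ k x := by positivity
    obtain ⟨K, hKn, hK⟩ := exists_low_energy_kernel e hpos (by positivity) (hC _ hE) x
    have h1 : ∑ j, ‖f j x‖ ^ 2 ≤ 2 * (∑ j, ‖inner ℂ (characterLp x) (u (k x) j)‖ ^ 2)
        + 2 * (C * ((2 : ℝ) ^ k x) ^ κ) := by
      calc ∑ j, ‖f j x‖ ^ 2 ≤ ∑ j, (2 * ‖inner ℂ (characterLp x) (u (k x) j)‖ ^ 2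
            + 2 * ‖inner ℂ K (b j : Lp ℂ 2 (torusMeasure d))‖ ^ 2) := by
            refine Finset.sum_le_sum fun j _ => ?_
            rw [hK (f j), hfb]
            have := norm_add_le (inner ℂ (characterLp x) (u (k x) j))
              (inner ℂ K (b j : Lp ℂ 2 (torusMeasure d)))
            refine (pow_le_pow_left₀ (norm_nonneg _) this 2).trans ?_
            nlinarith [sq_nonneg (‖inner ℂ (characterLp x) (u (k x) j)‖
              - ‖inner ℂ K (b j : Lp ℂ 2 (torusMeasure d))‖)]
        _ ≤ _ := by
            rw [Finset.sum_add_distrib, ← Finset.mul_sum, ← Finset.mul_sum]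
            gcongr
            refine le_trans ?_ hKn
            simp_rw [norm_inner_symm K]
            exact hbo.sum_inner_products_le K
    have h2 : w x * ((2 : ℝ) ^ k x) ^ κ ≤ 16 ^ κ * w x ^ ((d : ℝ) / 2) := by
      calc w x * ((2 : ℝ) ^ k x) ^ κ ≤ w x * (16 * w x) ^ κ := by
            gcongr
            exact hk2 x h
        _ = 16 ^ κ * (w x ^ κ * w x) := by rw [Real.mul_rpow (by norm_num) h.le]; ring
        _ = _ := by
            rw [← Real.rpow_add_one h.ne', hκ]
            congr 2; ring
    set ρ := ∑ j, ‖inner ℂ (characterLp x) (u (k x) j)‖ ^ 2 with hρ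
    have hρ0 : 0 ≤ ρ := Finset.sum_nonneg fun j _ => by positivity
    calc w x * ∑ j, ‖f j x‖ ^ 2 ≤ w x * (2 * ρ + 2 * (C * ((2 : ℝ) ^ k x) ^ κ)) := by gcongr
      _ = 1 / 4 * (8 * w x * ρ) + 2 * C * (w x * ((2 : ℝ) ^ k x) ^ κ) := by ring
      _ ≤ 1 / 4 * ((2 : ℝ) ^ k x * ρ) + 2 * C * (16 ^ κ * w x ^ ((d : ℝ) / 2)) := by
          gcongr
          exact hk1 x
      _ = _ := by ring
  -- Sites are grouped by their scale. At each scale Bessel's inequality for the characters gives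
  -- the norm of one cutoff, and the layer cake sums the scales to twice the energy of f j, which is
  -- 1.
  have hhigh : ∀ F : Finset (IntLattice d),
      ∑ x ∈ F, (2 : ℝ) ^ k x * ∑ j, ‖inner ℂ (characterLp x) (u (k x) j)‖ ^ 2 ≤ 2 * N := by
    classical
    intro F
    simp_rw [Finset.mul_sum]
    rw [Finset.sum_comm]
    have hj : ∀ j, ∑ x ∈ F, (2 : ℝ) ^ k x * ‖inner ℂ (characterLp x) (u (k x) j)‖ ^ 2 ≤ 2 := by
      intro j
      rw [← Finset.sum_fiberwise_of_maps_to (t := F.image k)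
        (fun x hx => Finset.mem_image_of_mem k hx)]
      calc ∑ n ∈ F.image k, ∑ x ∈ F with k x = n,
            (2 : ℝ) ^ k x * ‖inner ℂ (characterLp x) (u (k x) j)‖ ^ 2
          ≤ ∑ n ∈ F.image k, (2 : ℝ) ^ n * ‖u n j‖ ^ 2 := by
            refine Finset.sum_le_sum fun n _ => ?_
            calc _ = ∑ x ∈ F with k x = n,
                  (2 : ℝ) ^ n * ‖inner ℂ (characterLp x) (u n j)‖ ^ 2 := by
                  refine Finset.sum_congr rfl fun x hx => ?_
                  rw [(Finset.mem_filter.mp hx).2]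
              _ ≤ _ := by
                  rw [← Finset.mul_sum]
                  gcongr
                  exact (orthonormal_characterLp d).sum_inner_products_le (u n j)
        _ ≤ 2 * ∫ p, e p * ‖fourierStar d (f j) p‖ ^ 2 ∂torusMeasure d :=
            sum_norm_cutoff_sq_le he.nonneg _ _
        _ = 2 := by rw [← re_inner_hopping, hone, mul_one]
    calc _ ≤ ∑ _j : Fin N, (2 : ℝ) := Finset.sum_le_sum fun j _ => hj j
      _ = 2 * N := by simp [mul_comm]
  have hsumf : Summable fun x => w x * ∑ j, ‖f j x‖ ^ 2 := by
    simp_rw [Finset.mul_sum]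
    exact summable_sum fun j _ => (hW _ (hfW j)).1
  -- The basis has unit energy, so summing the form inequality over it produces the dimension.
  have h1 : (N : ℝ) ≤ ∑' x, w x * ∑ j, ‖f j x‖ ^ 2 := by
    simp_rw [Finset.mul_sum]
    rw [Summable.tsum_finsetSum fun j _ => (hW _ (hfW j)).1]
    calc (N : ℝ) = ∑ j : Fin N, (inner ℂ (f j) (hopping e (f j))).re := by simp [hone]
      _ ≤ _ := Finset.sum_le_sum fun j _ => (hW _ (hfW j)).2
  have h2 : ∑' x, w x * ∑ j, ‖f j x‖ ^ 2 ≤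
      1 / 4 * (2 * N) + 2 * C * 16 ^ κ * ∑' x, w x ^ ((d : ℝ) / 2) := by
    refine hsumf.tsum_le_of_sum_le fun F => ?_
    refine (Finset.sum_le_sum fun x _ => hpt x).trans ?_
    rw [Finset.sum_add_distrib, ← Finset.mul_sum, ← Finset.mul_sum]
    gcongr
    · exact hhigh F
    · exact hsum.sum_le_tsum F fun x _ => Real.rpow_nonneg (hw x) _
  -- Here N ≤ N/2 + 2C 16^κ ∑ w^{d/2}; absorbing N/2 gives the constant 4C 16^κ.
  linarith

/-! ### Phase space bounds -/

/-- The number of bound states is at most a constant times the truncated power sum of `V`. -/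
theorem exists_boundStates_le (hd : 3 ≤ d) {e : C(Torus d, ℝ)} (he : IsAdmissible e) :
    ∃ C : ℝ, 0 < C ∧ ∀ V : Potential d, (∀ x, 0 ≤ V x) →
      boundStates e V ≤ ENNReal.ofReal C *
        ∑' x, ENNReal.ofReal (min (V x) 1 ^ ((d : ℝ) / 2)) := by
  classical
  obtain ⟨C, hC0, hC⟩ := exists_finrank_le_sum_rpow hd he
  have ha : 0 < (d : ℝ) / 2 := by
    have : (3 : ℝ) ≤ d := by exact_mod_cast hd
    linarith
  refine ⟨1 + C, by positivity, fun V hV => boundStates_le fun W hWfd hW => ?_⟩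
  set m : IntLattice d → ℝ := fun x => min (V x) 1 ^ ((d : ℝ) / 2) with hm
  have hm0 : ∀ x, 0 ≤ m x := fun x => Real.rpow_nonneg (le_min (hV x) zero_le_one) _
  by_cases htop : ∑' x, ENNReal.ofReal (m x) = ∞
  · rw [htop, ENNReal.mul_top (by rw [ne_eq, ENNReal.ofReal_eq_zero]; linarith)]
    exact le_top
  have hms : Summable m := by
    have := ENNReal.summable_toReal htop
    simpa [ENNReal.toReal_ofReal, hm0] using this
  rw [← ENNReal.ofReal_tsum_of_nonneg hm0 hms, ← ENNReal.ofReal_mul (by positivity),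
    ← ENNReal.ofReal_natCast]
  refine ENNReal.ofReal_le_ofReal ?_
  have hm1 : ∀ x, 1 ≤ V x → m x = 1 := fun x hx => by simp [hm, min_eq_right hx]
  have hfin : {x | 1 ≤ V x}.Finite := by
    have h := hms.tendsto_cofinite_zero.eventually (gt_mem_nhds one_pos)
    rw [Filter.Eventually, mem_cofinite] at h
    refine h.subset fun x hx => ?_
    simp [hm1 x hx]
  set S := hfin.toFinset with hS
  have hSmem : ∀ x, x ∈ S ↔ 1 ≤ V x := fun x => by simp [hS]
  have hScard : (S.card : ℝ) ≤ ∑' x, m x := by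
    refine le_trans (le_of_eq ?_) (hms.sum_le_tsum S fun x _ => hm0 x)
    rw [Finset.sum_congr rfl fun x hx => hm1 x ((hSmem x).mp hx)]
    simp
  -- The kernel of evaluation on `S` has codimension at most #S in `W`, and on it V may be replaced
  -- by its part below 1.
  let ev : HilbertSpace d →ₗ[ℂ] (S → ℂ) := LinearMap.pi fun x =>
    lp.evalₗ (𝕜 := ℂ) (E := fun _ : IntLattice d => ℂ) (p := 2) (x : IntLattice d)
  let L : W →ₗ[ℂ] (S → ℂ) := ev.comp W.subtype
  have hrank := L.finrank_range_add_finrank_ker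
  have hrange : Module.finrank ℂ (LinearMap.range L) ≤ S.card := by
    refine (Submodule.finrank_le _).trans ?_
    simp
  set W' := (LinearMap.ker L).map W.subtype with hW'
  have hfr : Module.finrank ℂ W' = Module.finrank ℂ (LinearMap.ker L) :=
    (LinearEquiv.finrank_eq (Submodule.equivMapOfInjective W.subtype W.injective_subtype _)).symm
  set w : IntLattice d → ℝ := fun x => if 1 ≤ V x then 0 else V x with hw
  have hw0 : ∀ x, 0 ≤ w x := fun x => by
    simp only [hw]; split_ifs
    exacts [le_rfl, hV x]
  have hwm : ∀ x, w x ^ ((d : ℝ) / 2) ≤ m x := fun x => by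
    simp only [hw]
    split_ifs with h
    · rw [Real.zero_rpow ha.ne']; exact hm0 x
    · simp only [hm]
      rw [min_eq_left (not_le.mp h).le]
  have hws : Summable fun x => w x ^ ((d : ℝ) / 2) :=
    hms.of_nonneg_of_le (fun x => Real.rpow_nonneg (hw0 x) _) hwm
  have hmain := hC w hw0 hws W' inferInstance fun φ hφ => by
    obtain ⟨ψ, hψ, rfl⟩ := Submodule.mem_map.mp hφ
    have hz : ∀ x ∈ S, (ψ : HilbertSpace d) x = 0 := fun x hx =>
      congrFun (LinearMap.mem_ker.mp hψ) ⟨x, hx⟩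
    have hfun : (fun x => w x * ‖(ψ : HilbertSpace d) x‖ ^ 2)
        = fun x => V x * ‖(ψ : HilbertSpace d) x‖ ^ 2 := by
      funext x
      by_cases h : 1 ≤ V x
      · simp [hz x ((hSmem x).mpr h)]
      · simp [hw, h]
    have h1 := hW ψ ψ.2
    rw [re_inner_schrodinger] at h1
    simp only [Submodule.subtype_apply]
    rw [hfun]
    exact ⟨(hasSum_re_inner_potentialMul V ψ).summable, by linarith⟩
  have h2 : ∑' x, w x ^ ((d : ℝ) / 2) ≤ ∑' x, m x := hws.tsum_le_tsum hwm hms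
  have h3 : (Module.finrank ℂ W : ℝ) ≤ S.card + Module.finrank ℂ W' := by
    rw [hfr]; exact_mod_cast (by omega)
  calc (Module.finrank ℂ W : ℝ) ≤ S.card + Module.finrank ℂ W' := h3
    _ ≤ ∑' x, m x + C * ∑' x, m x := add_le_add hScard (hmain.trans (by gcongr))
    _ = _ := by ring

/-- Site by site from `le_measure_sublevel`; with the reverse bound below, it lets the truncated
power sum stand in for the phase space volume. -/
theorem exists_le_semiclassical (hd : 0 < d) {e : C(Torus d, ℝ)} (he : IsAdmissible e) :
    ∃ c : ℝ, 0 < c ∧ ∀ V : Potential d, (∀ x, 0 ≤ V x) →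
      ENNReal.ofReal c * ∑' x, ENNReal.ofReal (min (V x) 1 ^ ((d : ℝ) / 2))
        ≤ semiclassical e V := by
  obtain ⟨c, hc0, hc⟩ := he.le_measure_sublevel
  refine ⟨c, hc0, fun V hV => ?_⟩
  rw [← ENNReal.tsum_mul_left]
  refine ENNReal.tsum_le_tsum fun x => ?_
  rcases (hV x).eq_or_lt with h | h
  · rw [← h, min_eq_left zero_le_one, Real.zero_rpow (by positivity)]
    simp
  · rw [← ENNReal.ofReal_mul hc0.le]
    refine (hc _ h).trans (le_of_eq ?_)
    simp only [sub_neg]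

theorem exists_semiclassical_le {e : C(Torus d, ℝ)} (he : IsAdmissible e) :
    ∃ C : ℝ, 0 < C ∧ ∀ V : Potential d, (∀ x, 0 ≤ V x) →
      semiclassical e V ≤
        ENNReal.ofReal C * ∑' x, ENNReal.ofReal (min (V x) 1 ^ ((d : ℝ) / 2)) := by
  obtain ⟨C, hC0, hC⟩ := he.measure_sublevel_le
  -- The extra 1 serves sites with V x > 1, where the measure is bounded by 1.
  refine ⟨C + 1, by positivity, fun V hV => ?_⟩
  rw [← ENNReal.tsum_mul_left]
  refine ENNReal.tsum_le_tsum fun x => ?_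
  simp only [sub_neg]
  rcases (hV x).eq_or_lt with h | h
  · have : {p | e p < V x} = ∅ := by
      ext p
      have := he.nonneg p
      simp only [Set.mem_ofPred_eq, Set.mem_empty_iff_false, iff_false, not_lt]
      linarith
    rw [this, measure_empty]
    exact zero_le
  · rw [← ENNReal.ofReal_mul (by positivity)]
    rcases le_or_gt (V x) 1 with h1 | h1
    · rw [min_eq_left h1]
      refine (hC _ h).trans (ENNReal.ofReal_le_ofReal ?_)
      have := Real.rpow_nonneg h.le ((d : ℝ) / 2)
      nlinarith
    · rw [min_eq_right h1.le, Real.one_rpow, mul_one]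
      refine prob_le_one.trans ?_
      rw [ENNReal.one_le_ofReal]
      linarith

/-! ### Level sets -/

theorem finite_level {V : Potential d} (hs : Summable fun x => V x ^ ((d : ℝ) / 2)) {α : ℝ} (hα : 0 < α) :
    {x | α ≤ V x}.Finite := by
  have h := hs.tendsto_cofinite_zero.eventually
    (gt_mem_nhds (show 0 < α ^ ((d : ℝ) / 2) by positivity))
  rw [Filter.Eventually, mem_cofinite] at h
  refine h.subset fun x hx => ?_
  have h1 : α ≤ V x := hx
  have : α ^ ((d : ℝ) / 2) ≤ V x ^ ((d : ℝ) / 2) := by gcongr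
  simpa using this

theorem tendsto_cofinite_zero_of_finite_level {V : IntLattice d → ℝ} (hV : ∀ x, 0 ≤ V x)
    (hfin : ∀ α : ℝ, 0 < α → {x | α ≤ V x}.Finite) : Tendsto V cofinite (𝓝 0) := by
  rw [Metric.tendsto_nhds]
  intro ε hε
  rw [Filter.Eventually, mem_cofinite]
  refine (hfin ε hε).subset fun x hx => ?_
  simpa [abs_of_nonneg (hV x)] using hx

theorem levelCount_mono {V : Potential d} {α β : ℝ} (h : α ≤ β) (hfin : {x | α ≤ V x}.Finite) :
    levelCount V β ≤ levelCount V α :=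
  Set.ncard_le_ncard (fun _ hx => h.trans hx) hfin

theorem eventually_levelCount_pos {V : Potential d} (hV : ∀ x, 0 ≤ V x) (hV0 : V ≠ 0)
    (hfin : ∀ α : ℝ, 0 < α → {x | α ≤ V x}.Finite) :
    ∀ᶠ l : ℝ in atTop, 0 < levelCount V (Real.exp (-l)) := by
  obtain ⟨x, hx⟩ : ∃ x, V x ≠ 0 := by
    by_contra! hcon
    exact hV0 (lp.ext (funext hcon))
  have hx0 : 0 < V x := lt_of_le_of_ne (hV x) hx.symm
  have h : Tendsto (fun l : ℝ => Real.exp (-l)) atTop (𝓝 0) :=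
    Real.tendsto_exp_neg_atTop_nhds_zero
  filter_upwards [h.eventually (gt_mem_nhds hx0)] with l hl
  exact (Set.ncard_pos (hfin _ (Real.exp_pos _))).mpr ⟨x, hl.le⟩

/-- Level counts grow as the level drops. Together with g₊ < 1 this makes g₊ a real number. -/
theorem zero_le_gPlus {V : Potential d} (hV : ∀ x, 0 ≤ V x) (hV0 : V ≠ 0)
    (hfin : ∀ α : ℝ, 0 < α → {x | α ≤ V x}.Finite) : 0 ≤ gPlus V := by
  refine le_trans ?_ (le_iSup _ (⟨1, Set.mem_Ioi.mpr one_pos⟩ : Set.Ioi (0 : ℝ)))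
  refine le_limsup_of_frequently_le (Eventually.frequently ?_)
  filter_upwards [eventually_levelCount_pos hV hV0 hfin] with l hl
  rw [← EReal.coe_zero, EReal.coe_le_coe_iff]
  refine mul_nonneg (by positivity) (sub_nonneg.mpr ?_)
  refine Real.log_le_log (by exact_mod_cast hl) ?_
  exact_mod_cast levelCount_mono (Real.exp_le_exp.mpr (by simp)) (hfin _ (Real.exp_pos _))

/-- Below the critical growth exponent level sets grow at most geometrically. -/
theorem eventually_levelCount_le {V : Potential d} (hd : 0 < d) (hV : ∀ x, 0 ≤ V x) (hV0 : V ≠ 0)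
    (hfin : ∀ α : ℝ, 0 < α → {x | α ≤ V x}.Finite) {γ : ℝ} (hγ : gPlus V < γ) :
    ∀ᶠ l : ℝ in atTop, ∀ n : ℕ, (levelCount V (Real.exp (-l - n)) : ℝ)
      ≤ Real.exp ((d : ℝ) / 2 * γ * n) * levelCount V (Real.exp (-l)) := by
  -- Only r = 1 is taken from the supremum. The unit step holds at every l beyond one threshold, so
  -- it iterates uniformly in n.
  have hlim : limsup (fun l : ℝ => ((2 / (d * (1 : ℝ)) *
      (Real.log (levelCount V (Real.exp (-l - 1)))
        - Real.log (levelCount V (Real.exp (-l)))) : ℝ) : EReal)) atTop < γ :=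
    (le_iSup (fun r : Set.Ioi (0 : ℝ) => limsup (fun l : ℝ => ((2 / (d * (r : ℝ)) *
      (Real.log (levelCount V (Real.exp (-l - r)))
        - Real.log (levelCount V (Real.exp (-l)))) : ℝ) : EReal)) atTop) ⟨1, Set.mem_Ioi.mpr one_pos⟩).trans_lt hγ
  have hev := (eventually_lt_of_limsup_lt hlim).and (eventually_levelCount_pos hV hV0 hfin)
  obtain ⟨l0, hl0⟩ := eventually_atTop.mp hev
  have hstep : ∀ l, l0 ≤ l → (levelCount V (Real.exp (-l - 1)) : ℝ)
      ≤ Real.exp ((d : ℝ) / 2 * γ) * levelCount V (Real.exp (-l)) := by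
    intro l hl
    obtain ⟨h1, h2⟩ := hl0 l hl
    have h3 := (hl0 (l + 1) (by linarith)).2
    rw [neg_add, ← sub_eq_add_neg] at h3
    have hd' : (0 : ℝ) < d := by exact_mod_cast hd
    have h2' : (0 : ℝ) < levelCount V (Real.exp (-l)) := by exact_mod_cast h2
    have h3' : (0 : ℝ) < levelCount V (Real.exp (-l - 1)) := by exact_mod_cast h3
    rw [EReal.coe_lt_coe_iff, mul_one, div_mul_eq_mul_div, div_lt_iff₀ hd'] at h1
    rw [← Real.exp_log h3', ← Real.exp_log h2', ← Real.exp_add, Real.exp_le_exp]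
    linarith
  filter_upwards [eventually_ge_atTop l0] with l hl n
  induction n with
  | zero => simp
  | succ n ih =>
    have h := hstep (l + n) (by have : (0 : ℝ) ≤ n := n.cast_nonneg; linarith)
    rw [show -(l + (n : ℝ)) - 1 = -l - ((n + 1 : ℕ) : ℝ) by push_cast; ring,
      show -(l + (n : ℝ)) = -l - n by ring] at h
    refine h.trans ((mul_le_mul_of_nonneg_left ih (Real.exp_pos _).le).trans (le_of_eq ?_))
    rw [← mul_assoc, ← Real.exp_add]
    congr 2
    push_cast; ring

/-- Layer cake decomposition of a truncated power sum along a geometric sequence of levels. -/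
theorem tsum_min_rpow_le {V : Potential d} (hd : 0 < d) (hV : ∀ x, 0 ≤ V x)
    (hfin : ∀ α : ℝ, 0 < α → {x | α ≤ V x}.Finite) (l : ℝ) :
    ∑' x, ENNReal.ofReal (min (Real.exp l * V x) 1 ^ ((d : ℝ) / 2)) ≤
      ∑' n : ℕ, ENNReal.ofReal (Real.exp (-((d : ℝ) / 2 * n)) *
        levelCount V (Real.exp (-l - (n + 1 : ℕ)))) := by
  have hcount : ∀ n : ℕ, ENNReal.ofReal (Real.exp (-((d : ℝ) / 2 * n)) *
        levelCount V (Real.exp (-l - (n + 1 : ℕ)))) =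
      ∑' x, Set.indicator {x | Real.exp (-l - (n + 1 : ℕ)) ≤ V x}
        (fun _ => ENNReal.ofReal (Real.exp (-((d : ℝ) / 2 * n)))) x := by
    intro n
    rw [← tsum_subtype, ENNReal.tsum_set_const, ENNReal.ofReal_mul (Real.exp_pos _).le,
      ENNReal.ofReal_natCast, mul_comm]
    congr 1
    rw [levelCount, ← (hfin _ (Real.exp_pos _)).cast_ncard_eq]
    simp
  simp_rw [hcount]
  rw [ENNReal.tsum_comm]
  refine ENNReal.tsum_le_tsum fun x => ?_
  rcases (hV x).eq_or_lt with h | h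
  · rw [← h, mul_zero, min_eq_left zero_le_one, Real.zero_rpow (by positivity)]
    simp
  -- On this logarithmic scale the layer ⌊s⌋₊ alone pays for the site; the level index is n + 1
  -- because s ≤ ⌊s⌋₊ + 1. Sites with s ≤ 0 fall into layer 0, whose weight is 1.
  set s : ℝ := -(l + Real.log (V x)) with hs
  have hVs : Real.exp l * V x = Real.exp (-s) := by
    rw [hs, neg_neg, Real.exp_add, Real.exp_log h]
  have hVl : V x = Real.exp (-l - s) := by
    rw [hs, show -l - -(l + Real.log (V x)) = Real.log (V x) by ring, Real.exp_log h]
  refine le_trans ?_ (ENNReal.le_tsum ⌊s⌋₊)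
  have hmem : x ∈ {x | Real.exp (-l - (⌊s⌋₊ + 1 : ℕ)) ≤ V x} := by
    show Real.exp _ ≤ V x
    rw [hVl, Real.exp_le_exp]
    have := (Nat.lt_floor_add_one s).le
    push_cast
    linarith
  rw [Set.indicator_of_mem hmem, hVs]
  refine ENNReal.ofReal_le_ofReal ?_
  rw [show -((d : ℝ) / 2 * (⌊s⌋₊ : ℝ)) = -(⌊s⌋₊ : ℝ) * ((d : ℝ) / 2) by ring, Real.exp_mul]
  refine Real.rpow_le_rpow (le_min (Real.exp_pos _).le zero_le_one) ?_ (by positivity)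
  rcases le_total s 0 with h0 | h0
  · rw [Nat.floor_of_nonpos h0]
    simp
  · refine (min_le_left _ _).trans (Real.exp_le_exp.mpr (neg_le_neg (Nat.floor_le h0)))

/-- Convexity of exp; it extracts a factor linear in 1 - γ from the sum of the geometric series. -/
theorem one_sub_exp_neg_mul_ge {a s : ℝ} (h0 : 0 ≤ s) (h1 : s ≤ 1) :
    s * (1 - Real.exp (-a)) ≤ 1 - Real.exp (-(a * s)) := by
  have h := convexOn_exp.2 (Set.mem_univ (-a)) (Set.mem_univ 0) h0 (sub_nonneg.mpr h1) (by ring)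
  simp only [smul_eq_mul, mul_zero, add_zero, Real.exp_zero, mul_one] at h
  rw [show s * -a = -(a * s) by ring] at h
  linarith

/-- Layer weights exp(-an) against counts growing at most like exp(aγn) leave the ratio q =
exp(-a(1-γ)) < 1, and 1/(1-q) is at most a constant over 1 - γ. -/
theorem eventually_tsum_min_rpow_le {V : Potential d} (hd : 0 < d) (hV : ∀ x, 0 ≤ V x)
    (hV0 : V ≠ 0) (hfin : ∀ α : ℝ, 0 < α → {x | α ≤ V x}.Finite) {γ : ℝ} (hγ : gPlus V < γ)
    (hγ0 : 0 ≤ γ) (hγ1 : γ < 1) :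
    ∀ᶠ l : ℝ in atTop,
      ENNReal.ofReal ((1 - γ) * (1 - Real.exp (-((d : ℝ) / 2))) * Real.exp (-((d : ℝ) / 2))) *
        ∑' x, ENNReal.ofReal (min (Real.exp l * V x) 1 ^ ((d : ℝ) / 2))
      ≤ (levelCount V (Real.exp (-l)) : ℝ≥0∞) := by
  set a := (d : ℝ) / 2 with ha
  have ha0 : 0 < a := by positivity
  filter_upwards [eventually_levelCount_le hd hV hV0 hfin hγ] with l hl
  set L : ℝ := ((levelCount V (Real.exp (-l)) : ℕ) : ℝ) with hL
  set q := Real.exp (-(a * (1 - γ))) with hq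
  have hq0 : 0 < q := Real.exp_pos _
  have hq1 : q < 1 := by
    rw [hq, Real.exp_lt_one_iff, neg_lt_zero]
    exact mul_pos ha0 (by linarith)
  have hterm : ∀ n : ℕ, Real.exp (-(a * n)) * levelCount V (Real.exp (-l - (n + 1 : ℕ)))
      ≤ Real.exp a * L * q ^ n := by
    intro n
    calc _ ≤ Real.exp (-(a * n)) * (Real.exp (a * γ * (n + 1 : ℕ)) * L) := by
          gcongr
          exact hl (n + 1)
      _ = Real.exp (a * γ) * L * q ^ n := by
          rw [hq, ← Real.exp_nat_mul, ← mul_assoc, ← Real.exp_add, mul_right_comm (Real.exp (a * γ)) L, ← Real.exp_add]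
          congr 2
          push_cast; ring
      _ ≤ _ := by
          gcongr
          nlinarith
  have hsum : ∑' x, ENNReal.ofReal (min (Real.exp l * V x) 1 ^ a)
      ≤ ENNReal.ofReal (Real.exp a * L * (1 - q)⁻¹) := by
    refine (tsum_min_rpow_le hd hV hfin l).trans ?_
    refine (ENNReal.tsum_le_tsum fun n => ENNReal.ofReal_le_ofReal (hterm n)).trans ?_
    rw [← ENNReal.ofReal_tsum_of_nonneg (fun n => by positivity)
      ((summable_geometric_of_lt_one hq0.le hq1).mul_left _), tsum_mul_left,
      tsum_geometric_of_lt_one hq0.le hq1]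
  have hea : Real.exp (-a) < 1 := by
    rw [Real.exp_lt_one_iff]; linarith
  have hpre : 0 ≤ (1 - γ) * (1 - Real.exp (-a)) := mul_nonneg (by linarith) (by linarith)
  refine (mul_le_mul_right hsum _).trans ?_
  rw [← ENNReal.ofReal_mul (by positivity), ← ENNReal.ofReal_natCast]
  refine ENNReal.ofReal_le_ofReal ?_
  have h1 := one_sub_exp_neg_mul_ge (a := a) (s := 1 - γ) (by linarith) (by linarith)
  have h2 : Real.exp (-a) * Real.exp a = 1 := by rw [← Real.exp_add]; simp
  have h3 : 0 < 1 - q := by linarith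
  calc _ = (Real.exp (-a) * Real.exp a) * L * (((1 - γ) * (1 - Real.exp (-a))) * (1 - q)⁻¹) := by
        ring
    _ ≤ (Real.exp (-a) * Real.exp a) * L * 1 := by
        refine mul_le_mul_of_nonneg_left ?_ (by positivity)
        rw [← div_eq_mul_inv, div_le_one h3]
        exact h1
    _ = L := by rw [h2]; ring

/-! ### Strong coupling and conclusion -/

theorem summable_rpow_of_memℓp {V : Potential d} (hd : 0 < d) (hV : ∀ x, 0 ≤ V x)
    (hmem : Memℓp (V : IntLattice d → ℝ) ((d : ℝ≥0∞) / 2)) :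
    Summable fun x => V x ^ ((d : ℝ) / 2) := by
  have hp : ((d : ℝ≥0∞) / 2).toReal = (d : ℝ) / 2 := by simp
  have h := hmem.summable (by rw [hp]; positivity)
  rw [hp] at h
  simpa only [Real.norm_of_nonneg (hV _)] using h

theorem semiclassical_pos (hd : 0 < d) {e : C(Torus d, ℝ)} (he : IsAdmissible e)
    {V : Potential d} (hV : ∀ x, 0 ≤ V x) (hV0 : V ≠ 0) : 0 < semiclassical e V := by
  obtain ⟨c, hc, hcV⟩ := exists_le_semiclassical hd he
  obtain ⟨x, hx⟩ : ∃ x, V x ≠ 0 := by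
    by_contra! hcon
    exact hV0 (lp.ext (funext hcon))
  have hx0 : 0 < V x := lt_of_le_of_ne (hV x) hx.symm
  refine lt_of_lt_of_le (ENNReal.mul_pos (by simpa using hc) ?_) (hcV V hV)
  refine (lt_of_lt_of_le ?_ (ENNReal.le_tsum x)).ne'
  rw [ENNReal.ofReal_pos]
  exact Real.rpow_pos_of_pos (lt_min hx0 one_pos) _

theorem semiclassical_lt_top {e : C(Torus d, ℝ)} (he : IsAdmissible e)
    {V : Potential d} (hV : ∀ x, 0 ≤ V x) (hs : Summable fun x => V x ^ ((d : ℝ) / 2)) :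
    semiclassical e V < ∞ := by
  obtain ⟨C, _, hCV⟩ := exists_semiclassical_le he
  refine (hCV V hV).trans_lt (ENNReal.mul_lt_top ENNReal.ofReal_lt_top ?_)
  refine lt_of_le_of_lt (ENNReal.tsum_le_tsum fun x => ENNReal.ofReal_le_ofReal
    (Real.rpow_le_rpow (le_min (hV x) zero_le_one) (min_le_left _ _) (by positivity))) ?_
  rw [← ENNReal.ofReal_tsum_of_nonneg (fun x => Real.rpow_nonneg (hV x) _) hs]
  exact ENNReal.ofReal_lt_top

theorem smul_nonneg_apply {V : Potential d} (hV : ∀ x, 0 ≤ V x) {lam : ℝ} (hlam : 0 < lam)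
    (x : IntLattice d) : 0 ≤ (lam • V) x :=
  mul_nonneg hlam.le (hV x)

/-- The semiclassical lower bound at strong coupling, for potentials with growth exponent below
one. -/
theorem exists_eventually_mul_semiclassical_le (hd : 0 < d) {e : C(Torus d, ℝ)}
    (he : IsAdmissible e) :
    ∃ c : ℝ, 0 < c ∧ ∀ V : Potential d, (∀ x, 0 ≤ V x) → V ≠ 0 →
      (Summable fun x => V x ^ ((d : ℝ) / 2)) → ∀ γ : ℝ, gPlus V < γ → 0 ≤ γ → γ < 1 →
      ∀ᶠ lam : ℝ in atTop, ENNReal.ofReal ((1 - γ) * c) * semiclassical e (lam • V)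
        ≤ boundStates e (lam • V) := by
  obtain ⟨C, hC0, hC⟩ := exists_semiclassical_le he
  obtain ⟨m, hm⟩ := he.range_eq
  have hem : ∀ p, e p ≤ m := fun p => (hm ▸ Set.mem_range_self p : e p ∈ Set.Icc 0 m).2
  have hm0 : 0 ≤ m := (he.nonneg 0).trans (hem 0)
  set a := (d : ℝ) / 2 with ha
  have ha0 : 0 < a := by positivity
  -- λ V x ≥ E then exceeds every value of `e` strictly, and E ≥ 1 gives min(λV, 1) ≤ E min(λV/E,
  -- 1).
  set E := m + 1 with hE
  have hE1 : 1 ≤ E := by linarith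
  have hE0 : 0 < E := by linarith
  have hea : Real.exp (-a) < 1 := by
    rw [Real.exp_lt_one_iff]; linarith
  have hea' : 0 < 1 - Real.exp (-a) := by linarith
  set b := (1 - Real.exp (-a)) * Real.exp (-a) with hb
  have hb0 : 0 < b := by positivity
  refine ⟨b / (C * E ^ a), by positivity, fun V hV hV0 hs γ hγ hγ0 hγ1 => ?_⟩
  have hfin : ∀ α : ℝ, 0 < α → {x | α ≤ V x}.Finite := fun α hα => finite_level hs hα
  -- With l = log(λ/E) the level exp(-l) is E/λ.
  have hlim : Tendsto (fun lam : ℝ => Real.log (lam / E)) atTop atTop :=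
    Real.tendsto_log_atTop.comp (tendsto_id.atTop_div_const hE0)
  filter_upwards [hlim.eventually (eventually_tsum_min_rpow_le hd hV hV0 hfin hγ hγ0 hγ1),
    eventually_gt_atTop 0] with lam hl hlam
  have hexp : Real.exp (Real.log (lam / E)) = lam / E := Real.exp_log (by positivity)
  have hexp' : Real.exp (-Real.log (lam / E)) = E / lam := by
    rw [Real.exp_neg, hexp, inv_div]
  rw [hexp, hexp'] at hl
  have hVlam : ∀ x, (lam • V) x = lam * V x := fun x => rfl
  have hN : (levelCount V (E / lam) : ℝ≥0∞) ≤ boundStates e (lam • V) := by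
    have hf := hfin (E / lam) (by positivity)
    have ht : Tendsto ((lam • V : Potential d) : IntLattice d → ℝ) cofinite (𝓝 0) := by
      have := (tendsto_cofinite_zero_of_finite_level hV hfin).const_mul lam
      rwa [mul_zero] at this
    have h := card_le_boundStates he.nonneg hem ht hf.toFinset fun x hx => by
      have h1 : E / lam ≤ V x := by simpa using hx
      rw [div_le_iff₀ hlam] at h1
      rw [hVlam]
      linarith
    rwa [← Set.ncard_eq_toFinset_card _ hf] at h
  have hsc : semiclassical e (lam • V) ≤ ENNReal.ofReal (C * E ^ a) *
      ∑' x, ENNReal.ofReal (min (lam / E * V x) 1 ^ a) := by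
    refine (hC _ (smul_nonneg_apply hV hlam)).trans ?_
    rw [ENNReal.ofReal_mul hC0.le, mul_assoc, ← ENNReal.tsum_mul_left (a := ENNReal.ofReal (E ^ a))]
    gcongr with x
    rw [← ENNReal.ofReal_mul (by positivity)]
    refine ENNReal.ofReal_le_ofReal ?_
    have hx0 : 0 ≤ lam / E * V x := mul_nonneg (by positivity) (hV x)
    rw [← Real.mul_rpow hE0.le (le_min hx0 zero_le_one)]
    refine Real.rpow_le_rpow (le_min (smul_nonneg_apply hV hlam x) zero_le_one) ?_ ha0.le
    rw [mul_min_of_nonneg _ _ hE0.le, hVlam, mul_one]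
    refine min_le_min (le_of_eq ?_) hE1
    field_simp
  calc ENNReal.ofReal ((1 - γ) * (b / (C * E ^ a))) * semiclassical e (lam • V)
      ≤ ENNReal.ofReal ((1 - γ) * (b / (C * E ^ a))) * (ENNReal.ofReal (C * E ^ a) *
        ∑' x, ENNReal.ofReal (min (lam / E * V x) 1 ^ a)) := by gcongr
    _ = ENNReal.ofReal ((1 - γ) * (1 - Real.exp (-a)) * Real.exp (-a)) *
        ∑' x, ENNReal.ofReal (min (lam / E * V x) 1 ^ a) := by
        have h1γ : 0 ≤ 1 - γ := by linarith
        rw [← mul_assoc, ← ENNReal.ofReal_mul (by positivity)]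
        congr 2
        rw [hb]
        field_simp
    _ ≤ _ := hl.trans hN

end LatticeSchrodinger

theorem theorem1p7 {d : ℕ} (hd : 3 ≤ d) (e : C(Torus d, ℝ)) (he : IsAdmissible e) :
    ∃ cs cg : ℝ, 0 < cs ∧ cs ≤ cg ∧
      ∀ V : Potential d, (∀ x, 0 ≤ V x) → Memℓp (V : IntLattice d → ℝ) ((d : ℝ≥0∞) / 2) → V ≠ 0 →
        (∀ lam : ℝ, 0 < lam →
          0 < semiclassical e (lam • V) ∧ semiclassical e (lam • V) < ∞) ∧
        (1 - gPlus V) * (cs : EReal) ≤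
          liminf (fun lam : ℝ =>
            ((boundStates e (lam • V) / semiclassical e (lam • V) : ℝ≥0∞) : EReal)) atTop ∧
        liminf (fun lam : ℝ =>
            ((boundStates e (lam • V) / semiclassical e (lam • V) : ℝ≥0∞) : EReal)) atTop ≤
          limsup (fun lam : ℝ =>
            ((boundStates e (lam • V) / semiclassical e (lam • V) : ℝ≥0∞) : EReal)) atTop ∧
        limsup (fun lam : ℝ =>
            ((boundStates e (lam • V) / semiclassical e (lam • V) : ℝ≥0∞) : EReal)) atTop ≤
          (cg : EReal) := by
  have hd0 : 0 < d := by omega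
  obtain ⟨C, hC0, hC⟩ := exists_boundStates_le hd he
  obtain ⟨c, hc0, hc⟩ := exists_le_semiclassical hd0 he
  obtain ⟨s, hs0, hs⟩ := exists_eventually_mul_semiclassical_le hd0 he
  -- The minimum enforces c_s ≤ c_g.
  refine ⟨min s (C / c), C / c, lt_min hs0 (by positivity), min_le_right _ _,
    fun V hV hmem hV0 => ?_⟩
  have hsum := summable_rpow_of_memℓp hd0 hV hmem
  have hfin : ∀ α : ℝ, 0 < α → {x | α ≤ V x}.Finite := fun α hα => finite_level hsum hα
  have hsc : ∀ lam : ℝ, 0 < lam →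
      0 < semiclassical e (lam • V) ∧ semiclassical e (lam • V) < ∞ := fun lam hlam => by
    refine ⟨semiclassical_pos hd0 he (smul_nonneg_apply hV hlam) (smul_ne_zero hlam.ne' hV0),
      semiclassical_lt_top he (smul_nonneg_apply hV hlam) ?_⟩
    refine (hsum.mul_left (lam ^ ((d : ℝ) / 2))).congr fun x => ?_
    rw [← Real.mul_rpow hlam.le (hV x)]
    rfl
  refine ⟨hsc, ?_, liminf_le_limsup, ?_⟩
  -- For g₊ ≥ 1, including g₊ = ∞, the left side is nonpositive while the ratio is nonnegative.
  · rcases le_or_gt 1 (gPlus V) with hg | hg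
    · refine le_trans ?_ (le_liminf_of_le (by isBoundedDefault)
        (Eventually.of_forall fun lam => EReal.coe_ennreal_nonneg _))
      refine EReal.mul_nonpos_iff.mpr (Or.inr ⟨?_, ?_⟩)
      · exact EReal.sub_nonpos.mpr hg
      · exact_mod_cast (lt_min hs0 (by positivity)).le
    · have hg0 := zero_le_gPlus hV hV0 hfin
      obtain ⟨g, hgeq⟩ : ∃ g : ℝ, gPlus V = g :=
        ⟨(gPlus V).toReal, (EReal.coe_toReal (hg.trans_le le_top).ne
          (EReal.bot_lt_zero.trans_le hg0).ne').symm⟩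
      have hg1 : g < 1 := by rw [hgeq] at hg; exact_mod_cast hg
      have hg0' : 0 ≤ g := by rw [hgeq] at hg0; exact_mod_cast hg0
      -- The bound is available only for γ strictly above g₊; the liminf does not depend on γ, so γ
      -- may decrease to g₊.
      have hlim : Tendsto (fun γ : ℝ => (((1 - γ) * min s (C / c) : ℝ) : EReal)) (𝓝[>] g)
          (𝓝 (((1 - g) * min s (C / c) : ℝ) : EReal)) := by
        have : Continuous fun γ : ℝ => (((1 - γ) * min s (C / c) : ℝ) : EReal) :=
          continuous_coe_real_ereal.comp (by fun_prop)
        exact (this.tendsto g).mono_left nhdsWithin_le_nhds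
      have hval : (1 - gPlus V) * ((min s (C / c) : ℝ) : EReal)
          = (((1 - g) * min s (C / c) : ℝ) : EReal) := by
        rw [hgeq, EReal.coe_mul, EReal.coe_sub, EReal.coe_one]
      rw [hval]
      refine le_of_tendsto hlim ?_
      filter_upwards [self_mem_nhdsWithin, nhdsWithin_le_nhds (gt_mem_nhds hg1)] with γ hγ hγ1
      have hγg : g < γ := hγ
      refine le_liminf_of_le (by isBoundedDefault) ?_
      filter_upwards [hs V hV hV0 hsum γ (by rw [hgeq]; exact_mod_cast hγg) (by linarith) hγ1,
        eventually_gt_atTop 0] with lam hlam hlam0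
      obtain ⟨h1, h2⟩ := hsc lam hlam0
      have h3 := (ENNReal.le_div_iff_mul_le (Or.inl h1.ne') (Or.inl h2.ne)).mpr hlam
      have h4 : (((1 - γ) * s : ℝ) : EReal) ≤
          ((boundStates e (lam • V) / semiclassical e (lam • V) : ℝ≥0∞) : EReal) := by
        refine le_trans ?_ (EReal.coe_ennreal_le_coe_ennreal_iff.mpr h3)
        rw [EReal.coe_ennreal_ofReal]
        exact_mod_cast le_max_left _ _
      refine le_trans ?_ h4
      rw [EReal.coe_le_coe_iff]
      exact mul_le_mul_of_nonneg_left (min_le_left _ _) (by linarith)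
  · refine limsup_le_of_le (by isBoundedDefault) ?_
    filter_upwards [eventually_gt_atTop 0] with lam hlam
    have h1 : boundStates e (lam • V) / semiclassical e (lam • V) ≤ ENNReal.ofReal (C / c) := by
      refine ENNReal.div_le_of_le_mul ((hC _ (smul_nonneg_apply hV hlam)).trans ?_)
      refine le_trans (le_of_eq ?_) (mul_le_mul_right (hc _ (smul_nonneg_apply hV hlam)) _)
      rw [← mul_assoc, ← ENNReal.ofReal_mul (by positivity), div_mul_cancel₀ _ hc0.ne']
    refine (EReal.coe_ennreal_le_coe_ennreal_iff.mpr h1).trans ?_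
    rw [EReal.coe_ennreal_ofReal, max_eq_left (by positivity)]
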